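/- For $n\ge 2$ let $F_n$ be the free group with ordered basis $a_1,\dots,a_n$. Let $K_n$ (the spine of Outer space) be the flag complex whose vertices are the minimal free simplicial actions of $F_n$ on simplicial trees without vertices of valence $2$, up to equivariant isomorphism (these trees are the universal covers of the finite graphs marked by $F_n$, all of whose vertices have valence at least $3$). Let $L_n$ (the spine of Auter space) be the flag complex whose vertices are the minimal free simplicial actions of $F_n$ on simplicial trees with a basepoint vertex, where only translates of the basepoint may have valence $2$, up to equivariant isomorphism preserving basepoints. In both complexes two different vertices are adjacent if one is obtained from the other by (preserving basepoints, for $L_n$) a forest collapse, i.e. by collapsing to a point each component of an $F_n$-invariant subgraph whose image in the quotient graph is a forest. Let $2\le m<n$ and identify $F_m$ with $\langle a_1,\dots,a_m\rangle\le F_n$. Then the following maps of vertices are well defined and are simplicial maps: - the forgetful maps $\phi_m\colon L_m\to K_m$ and $\phi_n\colon L_n\to K_n$, which forget the basepoint (a point of valence $2$ is then no longer considered to be a vertex); - the augmentation map $\iota\colon L_m\to L_n$, which attaches to the marked quotient graph, at its basepoint, a bouquet of $n-m$ circles marked with $a_{m+1},\dots,a_n$; in terms of trees, $(X,p)$ is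 sent to the tree with vertex set $F_n\times_{F_m}X$, whose edges are the translates of the edges of $X$ and the edges joining $gp$ to $ga_ip$ for $g\in F_n$, $m<i\le n$, with basepoint $p$; - the restriction map $\rho\colon K_n\to K_m$, which sends a tree to its minimal $F_m$-invariant subtree, whose points of valence $2$ are no longer considered to be vertices. Moreover $\rho\circ\phi_n\circ\iota=\phi_m$. -/

import Mathlib

/-! ### Simplicial complexes and simplicial maps -/

/-- The flag complex of a simple graph: its simplices are the nonempty finite sets of pairwise
adjacent vertices. -/
def flagComplex {α : Type*} (A : SimpleGraph α) : AbstractSimplicialComplex α where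
  faces := {s | s.Nonempty ∧ A.IsClique (s : Set α)}
  isRelLowerSet_faces := fun {_} hs =>
    ⟨hs.1, fun _ hts ht => ⟨ht, hs.2.subset (Finset.coe_subset.mpr hts)⟩⟩
  singleton_mem v := ⟨Finset.singleton_nonempty v, by simp⟩

/-- A simplicial map: a map of vertices that sends simplices to (possibly lower dimensional)
simplices. -/
structure SimplicialMap {α β : Type*} (K : AbstractSimplicialComplex α)
    (L : AbstractSimplicialComplex β) where
  /-- the map on vertices -/
  toFun : α → β
  /-- the image of a simplex is a simplex -/
  map_face : ∀ s ∈ K.faces, ∃ t ∈ L.faces, (t : Set β) = toFun '' (s : Set α)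

/-! ### Simplicial group actions on graphs -/

/-- A simple graph with a simplicial action of the group `G`. -/
structure GGraph (G : Type) [Group G] where
  /-- the vertices -/
  V : Type
  /-- the graph -/
  graph : SimpleGraph V
  /-- the action on the vertices -/
  act : MulAction G V
  /-- the action preserves adjacency -/
  smul_adj : ∀ (g : G) (u v : V), graph.Adj u v → graph.Adj (g • u) (g • v)

attribute [instance] GGraph.act

namespace GGraph

variable {G : Type} [Group G]

/-- The action is free. When `G` is torsion free, an edge cannot be inverted (the square of an
element inverting an edge fixes the ends of the edge), so that this is freeness on the geometric
realization as well. -/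
def IsFree (X : GGraph G) : Prop :=
  ∀ (g : G) (v : X.V), g • v = v → g = 1

/-- `S` is the vertex set of a nonempty `G`-invariant subtree (in a tree, the connected subgraphs
are the subtrees, and they are induced by their vertex sets). -/
def IsInvariantSubtree (X : GGraph G) (S : Set X.V) : Prop :=
  (∀ (g : G), ∀ v ∈ S, g • v ∈ S) ∧ (X.graph.induce S).Connected

/-- The action is minimal: there is no proper nonempty invariant subtree. -/
def IsMinimal (X : GGraph G) : Prop :=
  ∀ S : Set X.V, X.IsInvariantSubtree S → S = Set.univ

/-- The valence of a vertex. -/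
noncomputable def valence (X : GGraph G) (v : X.V) : ℕ∞ :=
  (X.graph.neighborSet v).encard

/-- `f` is an equivariant isomorphism of graphs. -/
def IsEquivariantIso (X Y : GGraph G) (f : X.graph ≃g Y.graph) : Prop :=
  ∀ (g : G) (v : X.V), f (g • v) = g • f v

/-- `f : X → Y` is (the lift to universal covers of) a forest collapse: there is an invariant
subgraph `F` of `X` whose image in the quotient graph `X / G` is a forest (that is, no nontrivial
element of `G` carries a vertex into its own component of `F`), and `f` identifies `Y`,
equivariantly, with the graph obtained from `X` by collapsing each component of `F` to a point. -/
def IsForestCollapse (X Y : GGraph G) (f : X.V → Y.V) : Prop :=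
  ∃ F : SimpleGraph X.V,
    F ≤ X.graph ∧
    (∀ (g : G) (u v : X.V), F.Adj u v → F.Adj (g • u) (g • v)) ∧
    (∀ (g : G) (u : X.V), F.Reachable u (g • u) → g = 1) ∧
    (∀ (g : G) (v : X.V), f (g • v) = g • f v) ∧
    Function.Surjective f ∧
    (∀ u v : X.V, f u = f v ↔ F.Reachable u v) ∧
    (∀ a b : Y.V, Y.graph.Adj a b ↔ a ≠ b ∧ ∃ u v : X.V, f u = a ∧ f v = b ∧ X.graph.Adj u v)

/-- An element of `G` acts as an endomorphism of the graph. -/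
def smulHom (X : GGraph G) (g : G) : X.graph →g X.graph where
  toFun v := g • v
  map_rel' h := X.smul_adj g _ _ h

theorem smul_adj_iff (X : GGraph G) (g : G) (u v : X.V) :
    X.graph.Adj (g • u) (g • v) ↔ X.graph.Adj u v :=
  ⟨fun h => by simpa using X.smul_adj g⁻¹ _ _ h, X.smul_adj g u v⟩

theorem valence_smul (X : GGraph G) (g : G) (v : X.V) : X.valence (g • v) = X.valence v := by
  have h : X.graph.neighborSet (g • v) = (fun w => g • w) '' X.graph.neighborSet v := by
    ext w
    constructor
    · intro hw
      refine ⟨g⁻¹ • w, ?_, smul_inv_smul g w⟩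
      have h1 : X.graph.Adj (g • v) (g • g⁻¹ • w) := by
        rw [smul_inv_smul]
        exact hw
      exact (X.smul_adj_iff g v (g⁻¹ • w)).mp h1
    · rintro ⟨u, hu, rfl⟩
      exact X.smul_adj g v u hu
  unfold valence
  rw [h, (MulAction.injective g).encard_image]

/-- The graph obtained by no longer considering the vertices of valence 2 as vertices: the vertices
are those of valence different from 2, and two of them are adjacent if they are joined by an
embedded path all of whose interior vertices have valence 2. -/
def erase (X : GGraph G) : GGraph G where
  V := {v : X.V // X.valence v ≠ 2}
  graph :=
    { Adj := fun u v => u ≠ v ∧ ∃ p : X.graph.Walk u.1 v.1, p.IsPath ∧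
        ∀ w ∈ p.support, w ≠ u.1 → w ≠ v.1 → X.valence w = 2
      symm := ⟨fun u v ⟨hne, p, hp, hw⟩ => ⟨hne.symm, p.reverse, hp.reverse, fun w hm h1 h2 =>
        hw w (by simpa using hm) h2 h1⟩⟩
      loopless := ⟨fun _ h => h.1 rfl⟩ }
  act :=
    { smul := fun g v => ⟨g • v.1, by rw [valence_smul]; exact v.2⟩
      one_smul := fun v => Subtype.ext (one_smul G v.1)
      mul_smul := fun g h v => Subtype.ext (mul_smul g h v.1) }
  smul_adj := by
    rintro g u v ⟨hne, p, hp, hw⟩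
    refine ⟨fun h => hne (Subtype.ext (MulAction.injective g (congrArg Subtype.val h))),
      p.map (X.smulHom g), SimpleGraph.Walk.IsPath.map (MulAction.injective g) hp, ?_⟩
    intro w hm h1 h2
    obtain ⟨x, hx, rfl⟩ := List.mem_map.mp
      ((congrArg (fun l => w ∈ l) (SimpleGraph.Walk.support_map (X.smulHom g) p)).mp hm)
    change X.valence (g • x) = 2
    rw [valence_smul]
    refine hw x hx ?_ ?_
    · rintro rfl
      exact h1 rfl
    · rintro rfl
      exact h2 rfl

/-- Restriction of the action along a homomorphism of groups. -/
def comap {H : Type} [Group H] (X : GGraph G) (f : H →* G) : GGraph H where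
  V := X.V
  graph := X.graph
  act := MulAction.compHom X.V f
  smul_adj h u v := X.smul_adj (f h) u v

/-- The minimal invariant subtree: the intersection of all nonempty invariant subtrees. -/
def minimalSubtree (X : GGraph G) : Set X.V :=
  ⋂₀ {S | X.IsInvariantSubtree S}

/-- The minimal invariant subtree, with the induced action. -/
def core (X : GGraph G) : GGraph G where
  V := X.minimalSubtree
  graph := X.graph.induce X.minimalSubtree
  act :=
    { smul := fun g v => ⟨g • v.1, fun S hS => hS.1 g v.1 (v.2 S hS)⟩
      one_smul := fun v => Subtype.ext (one_smul G v.1)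
      mul_smul := fun g h v => Subtype.ext (mul_smul g h v.1) }
  smul_adj g u v h := X.smul_adj g u.1 v.1 h

end GGraph

/-! ### The spines of Outer space and of Auter space -/

/-- The vertices of the spine of Outer space are represented by the minimal free simplicial actions
of the free group on trees without vertices of valence 2. -/
structure OuterTree (n : ℕ) where
  /-- the tree with its action -/
  X : GGraph (FreeGroup (Fin n))
  isTree : X.graph.IsTree
  isFree : X.IsFree
  isMinimal : X.IsMinimal
  valence_ne : ∀ v : X.V, X.valence v ≠ 2

/-- The vertices of the spine of Auter space are represented by the minimal free simplicial actions
of the free group on trees with a basepoint, where only the translates of the basepoint may have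
valence 2. -/
structure AuterTree (n : ℕ) where
  /-- the tree with its action -/
  X : GGraph (FreeGroup (Fin n))
  /-- the basepoint -/
  base : X.V
  isTree : X.graph.IsTree
  isFree : X.IsFree
  isMinimal : X.IsMinimal
  valence_ne : ∀ v : X.V, (∀ g : FreeGroup (Fin n), v ≠ g • base) → X.valence v ≠ 2

/-- Equivariantly isomorphic trees represent the same vertex of the spine of Outer space. -/
instance outerSetoid (n : ℕ) : Setoid (OuterTree n) where
  r S T := ∃ f : S.X.graph ≃g T.X.graph, GGraph.IsEquivariantIso S.X T.X f
  iseqv :=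
    { refl := fun _ => ⟨SimpleGraph.Iso.refl, fun _ _ => rfl⟩
      symm := by
        rintro S T ⟨f, hf⟩
        refine ⟨f.symm, fun g v => ?_⟩
        apply f.injective
        rw [hf, f.apply_symm_apply, f.apply_symm_apply]
      trans := by
        rintro S T U ⟨f, hf⟩ ⟨f', hf'⟩
        refine ⟨f.trans f', fun g v => ?_⟩
        change f' (f (g • v)) = g • f' (f v)
        rw [hf, hf'] }

/-- Based trees represent the same vertex of the spine of Auter space if there is an equivariant
isomorphism that preserves the basepoints. -/
instance auterSetoid (n : ℕ) : Setoid (AuterTree n) where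
  r S T := ∃ f : S.X.graph ≃g T.X.graph, GGraph.IsEquivariantIso S.X T.X f ∧ f S.base = T.base
  iseqv :=
    { refl := fun _ => ⟨SimpleGraph.Iso.refl, fun _ _ => rfl, rfl⟩
      symm := by
        rintro S T ⟨f, hf, hb⟩
        refine ⟨f.symm, fun g v => ?_, ?_⟩
        · apply f.injective
          rw [hf, f.apply_symm_apply, f.apply_symm_apply]
        · rw [← hb, f.symm_apply_apply]
      trans := by
        rintro S T U ⟨f, hf, hb⟩ ⟨f', hf', hb'⟩
        refine ⟨f.trans f', fun g v => ?_, ?_⟩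
        · change f' (f (g • v)) = g • f' (f v)
          rw [hf, hf']
        · change f' (f S.base) = U.base
          rw [hb, hb'] }

/-- The vertices of the spine of Outer space of rank `n`. -/
def OuterVertex (n : ℕ) : Type 1 := Quotient (outerSetoid n)

/-- The vertices of the spine of Auter space of rank `n`. -/
def AuterVertex (n : ℕ) : Type 1 := Quotient (auterSetoid n)

/-- The vertex represented by a tree. -/
def OuterTree.toVertex {n : ℕ} (T : OuterTree n) : OuterVertex n := Quotient.mk _ T

/-- The vertex represented by a based tree. -/
def AuterTree.toVertex {n : ℕ} (T : AuterTree n) : AuterVertex n := Quotient.mk _ T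

/-- The spine of Outer space: the flag complex in which two different vertices are adjacent if one
is obtained from the other by a forest collapse. -/
def outerSpine (n : ℕ) : AbstractSimplicialComplex (OuterVertex n) :=
  flagComplex (SimpleGraph.fromRel fun x y => ∃ S T : OuterTree n,
    S.toVertex = x ∧ T.toVertex = y ∧ ∃ f : S.X.V → T.X.V, GGraph.IsForestCollapse S.X T.X f)

/-- The spine of Auter space: the flag complex in which two different vertices are adjacent if one
is obtained from the other by a (basepoint preserving) forest collapse. -/
def auterSpine (n : ℕ) : AbstractSimplicialComplex (AuterVertex n) :=
  flagComplex (SimpleGraph.fromRel fun x y => ∃ S T : AuterTree n,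
    S.toVertex = x ∧ T.toVertex = y ∧
      ∃ f : S.X.V → T.X.V, GGraph.IsForestCollapse S.X T.X f ∧ f S.base = T.base)

/-! ### The three natural maps -/

/-- The inclusion of `F_m` into `F_n` as the subgroup generated by the first `m` elements of the
basis of `F_n`. -/
def freeIncl {m n : ℕ} (h : m ≤ n) : FreeGroup (Fin m) →* FreeGroup (Fin n) :=
  FreeGroup.map (Fin.castLE h)

/-- The relation `(g k, x) ~ (g, k x)`, for `k` in `F_m`, on `F_n × X`. Its quotient is the set
`F_n ×_{F_m} X`. -/
def inducedSetoid {m n : ℕ} (h : m ≤ n) (X : GGraph (FreeGroup (Fin m))) :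
    Setoid (FreeGroup (Fin n) × X.V) where
  r a b := ∃ k : FreeGroup (Fin m), a.1 = b.1 * freeIncl h k ∧ b.2 = k • a.2
  iseqv :=
    { refl := fun a => ⟨1, by simp, by simp⟩
      symm := by
        rintro a b ⟨k, h1, h2⟩
        exact ⟨k⁻¹, by simp [h1], by simp [h2]⟩
      trans := by
        rintro a b c ⟨k, h1, h2⟩ ⟨l, h3, h4⟩
        exact ⟨l * k, by simp [h1, h3, mul_assoc], by simp [h2, h4, mul_smul]⟩ }

/-- The set `F_n ×_{F_m} X`. -/
def Induced {m n : ℕ} (h : m ≤ n) (X : GGraph (FreeGroup (Fin m))) : Type :=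
  Quotient (inducedSetoid h X)

/-- The element of `F_n ×_{F_m} X` represented by `(g, x)`. -/
def Induced.mk {m n : ℕ} (h : m ≤ n) (X : GGraph (FreeGroup (Fin m))) (g : FreeGroup (Fin n))
    (x : X.V) : Induced h X :=
  Quotient.mk (inducedSetoid h X) (g, x)

/-- The action of `F_n` on `F_n ×_{F_m} X` by multiplication from the left. -/
instance Induced.mulAction {m n : ℕ} (h : m ≤ n) (X : GGraph (FreeGroup (Fin m))) :
    MulAction (FreeGroup (Fin n)) (Induced h X) where
  smul g := Quotient.map (sa := inducedSetoid h X) (sb := inducedSetoid h X)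
    (fun a => (g * a.1, a.2)) (by
      rintro a b ⟨k, h1, h2⟩
      exact ⟨k, by simp [h1, mul_assoc], h2⟩)
  one_smul := by
    rintro ⟨a⟩
    change Quotient.mk (inducedSetoid h X) (1 * a.1, a.2) = Quotient.mk (inducedSetoid h X) a
    rw [one_mul]
  mul_smul := by
    rintro g g' ⟨a⟩
    change Quotient.mk (inducedSetoid h X) (g * g' * a.1, a.2) =
      Quotient.mk (inducedSetoid h X) (g * (g' * a.1), a.2)
    rw [mul_assoc]

theorem Induced.smul_mk {m n : ℕ} (h : m ≤ n) (X : GGraph (FreeGroup (Fin m)))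
    (g g' : FreeGroup (Fin n)) (x : X.V) :
    g • Induced.mk h X g' x = Induced.mk h X (g * g') x := rfl

/-- Let `X` be the universal cover of a graph `Γ` whose fundamental group, at the image of the
vertex `p`, is identified with `F_m`. Attach to `Γ`, at the image of `p`, a bouquet of `n - m`
circles, marked with the last `n - m` basis elements of `F_n`. This is the universal cover of the
resulting graph, with its action of `F_n`: it consists of the disjoint copies `g X` of `X`, one for
each coset `g F_m`, and of the lifts of the circles, which are the edges that join `g p` to
`g a_i p`, where `g` is any element of `F_n` and `a_i` is one of the last `n - m` basis elements. -/
def augment {m n : ℕ} (h : m ≤ n) (X : GGraph (FreeGroup (Fin m))) (p : X.V) :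
    GGraph (FreeGroup (Fin n)) where
  V := Induced h X
  graph := SimpleGraph.fromRel fun a b =>
    (∃ (g : FreeGroup (Fin n)) (x y : X.V), X.graph.Adj x y ∧
      a = Induced.mk h X g x ∧ b = Induced.mk h X g y) ∨
    (∃ (g : FreeGroup (Fin n)) (i : Fin n), m ≤ i.val ∧
      a = Induced.mk h X g p ∧ b = Induced.mk h X (g * FreeGroup.of i) p)
  act := Induced.mulAction h X
  smul_adj := by
    have key : ∀ (g : FreeGroup (Fin n)) (a b : Induced h X),
        ((∃ (g : FreeGroup (Fin n)) (x y : X.V), X.graph.Adj x y ∧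
          a = Induced.mk h X g x ∧ b = Induced.mk h X g y) ∨
        (∃ (g : FreeGroup (Fin n)) (i : Fin n), m ≤ i.val ∧
          a = Induced.mk h X g p ∧ b = Induced.mk h X (g * FreeGroup.of i) p)) →
        ((∃ (g' : FreeGroup (Fin n)) (x y : X.V), X.graph.Adj x y ∧
          g • a = Induced.mk h X g' x ∧ g • b = Induced.mk h X g' y) ∨
        (∃ (g' : FreeGroup (Fin n)) (i : Fin n), m ≤ i.val ∧
          g • a = Induced.mk h X g' p ∧ g • b = Induced.mk h X (g' * FreeGroup.of i) p)) := by
      rintro g a b (⟨g', x, y, hxy, rfl, rfl⟩ | ⟨g', i, hi, rfl, rfl⟩)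
      · exact Or.inl ⟨g * g', x, y, hxy, rfl, rfl⟩
      · exact Or.inr ⟨g * g', i, hi, rfl, by rw [Induced.smul_mk, mul_assoc]⟩
    intro g a b hab
    rw [SimpleGraph.fromRel_adj] at hab ⊢
    exact ⟨fun he => hab.1 (MulAction.injective g he), hab.2.imp (key g a b) (key g b a)⟩

/-- The minimal `F_m`-invariant subtree of a tree with an action of `F_n`, with its vertices of
valence 2 erased. -/
def restrictTree {m n : ℕ} (h : m ≤ n) (X : GGraph (FreeGroup (Fin n))) :
    GGraph (FreeGroup (Fin m)) :=
  (X.comap (freeIncl h)).core.erase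

/-- `φ` is the forgetful map `L_n → K_n`: it forgets the basepoint (which is then no longer
considered to be a vertex if it has valence 2). -/
def IsForgetfulMap {n : ℕ} (φ : SimplicialMap (auterSpine n) (outerSpine n)) : Prop :=
  ∀ T : AuterTree n, ∃ S : OuterTree n, S.X = T.X.erase ∧ φ.toFun T.toVertex = S.toVertex

/-- `ι` is the augmentation map `L_m → L_n`. -/
def IsAugmentationMap {m n : ℕ} (h : m ≤ n)
    (ι : SimplicialMap (auterSpine m) (auterSpine n)) : Prop :=
  ∀ T : AuterTree m, ∃ (ht : (augment h T.X T.base).graph.IsTree)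
    (hf : (augment h T.X T.base).IsFree) (hm : (augment h T.X T.base).IsMinimal)
    (hv : ∀ v : Induced h T.X, (∀ g : FreeGroup (Fin n), v ≠ g • Induced.mk h T.X 1 T.base) →
      (augment h T.X T.base).valence v ≠ 2),
    ι.toFun T.toVertex =
      AuterTree.toVertex ⟨augment h T.X T.base, Induced.mk h T.X 1 T.base, ht, hf, hm, hv⟩

/-- `ρ` is the restriction map `K_n → K_m`. -/
def IsRestrictionMap {m n : ℕ} (h : m ≤ n)
    (ρ : SimplicialMap (outerSpine n) (outerSpine m)) : Prop :=
  ∀ T : OuterTree n, ∃ S : OuterTree m, S.X = restrictTree h T.X ∧ ρ.toFun T.toVertex = S.toVertex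

/-! All the maps are controlled through equivariant surjections with connected fibres
(`IsCollapse`). A forest collapse is such a map; conversely, such a map is a forest collapse as soon
as its target is free, and the injective ones are isomorphisms. It therefore suffices that each
construction turns a collapse into a collapse, and an injective one into an injective one. This
gives at once that the map is well defined on isomorphism classes and that it respects adjacency,
and a flag complex asks for nothing more.

The geometry of trees is expressed by the relation `Between`, which collapses preserve
(`IsCollapse.map_between`) and which passes unchanged to subtrees and to trees with erased vertices.

Erasing: in a minimal free tree the vertices of valence different from 2 are the branch vertices.
Collapses send branch vertices to branch vertices and hit all of them (`IsCollapse.isBranch`,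
`IsCollapse.exists_isBranch`). In rank at least 2 a branch vertex exists, by counting, so that the
branch vertices span the tree.

Restricting: the minimal invariant subtree is nonempty because it contains every vertex that some
fixed nontrivial element displaces least. Images and preimages of invariant subtrees under a
collapse are invariant subtrees, so collapses restrict to minimal subtrees.

Augmenting: the graph is acyclic because it carries a potential modulo 2, which sends a vertex to
the edge set of its path from the basepoint. On `X` this potential is equivariant for an affine
action of `F_m`; freeness of `F_n` extends the action, and with it the potential (`augment_isTree`).

The composite: since `m < n`, the basepoint of the augmentation is a branch vertex, so forgetting it
erases nothing; and the minimal `F_m`-invariant subtree of the augmentation is the original copy of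
`X`. -/

/-! ### Betweenness in trees -/

namespace SimpleGraph

section Between

variable {V : Type*} {T : SimpleGraph V} {a b d e u v w x y : V}

/-- Every walk from `u` to `v` passes through `w`. In a tree, this says that `w` lies on the path
from `u` to `v`. -/
def Between (T : SimpleGraph V) (u w v : V) : Prop := ∀ p : T.Walk u v, w ∈ p.support

theorem Between.left (T : SimpleGraph V) (u v : V) : T.Between u u v := fun p => p.start_mem_support

theorem Between.right (T : SimpleGraph V) (u v : V) : T.Between u v v := fun p => p.end_mem_support

theorem Between.symm (h : T.Between u w v) : T.Between v w u := fun p => by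
  simpa using h p.reverse

theorem Between.eq (h : T.Between u w u) : w = u := by
  simpa using h Walk.nil

theorem Between.exists_of_hom {W : Type*} {G : SimpleGraph W} (f : G →g T) {u v : W} {w : V}
    (h : T.Between (f u) w (f v)) (p : G.Walk u v) : ∃ x ∈ p.support, f x = w := by
  simpa [Walk.support_map] using h (p.map f)

/-- Otherwise two walks avoiding `w` could be concatenated at `x`. This trichotomy-like rule, valid
in every graph, replaces most case analysis of paths. -/
theorem Between.split (h : T.Between u w v) (x : V) : T.Between u w x ∨ T.Between x w v := by
  by_contra! hc
  simp only [Between, not_forall] at hc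
  obtain ⟨⟨p, hp⟩, q, hq⟩ := hc
  have := h (p.append q)
  rw [Walk.mem_support_append_iff] at this
  tauto

theorem Between.eq_or_eq (h : T.Between u w v) (huv : T.Adj u v) : w = u ∨ w = v := by
  simpa using h huv.toWalk

/-- A path from `u` to `v`, cut off at `w`, no longer contains its endpoint `v` unless `w = v`. -/
theorem Connected.between_antisymm (hT : T.Connected) (h1 : T.Between u w v)
    (h2 : T.Between u v w) : w = v := by
  classical
  obtain ⟨p, hp, -⟩ := hT.exists_path_of_dist u v
  by_contra hne
  have hw := h1 p
  have h3 := h2 (p.takeUntil w hw)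
  exact Walk.endpoint_notMem_support_takeUntil hp hw (Ne.symm hne) h3

theorem Between.trans_left (h1 : T.Between u w v) (h2 : T.Between u x w) : T.Between u x v := by
  classical
  intro p
  exact p.support_takeUntil_subset_support (h1 p) (h2 (p.takeUntil w (h1 p)))

theorem Between.trans_right (h1 : T.Between u w v) (h2 : T.Between w x v) : T.Between u x v :=
  (h1.symm.trans_left h2.symm).symm

theorem Connected.dist_add_of_between (hT : T.Connected) (h : T.Between u w v) :
    T.dist u w + T.dist w v = T.dist u v := by
  classical
  apply le_antisymm _ hT.dist_triangle
  obtain ⟨p, hp⟩ := hT.exists_walk_length_eq_dist u v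
  rw [← hp, ← congrArg Walk.length (p.take_spec (h p)), Walk.length_append]
  exact add_le_add (dist_le _) (dist_le _)

theorem IsTree.between_iff (hT : T.IsTree) {p : T.Walk u v} (hp : p.IsPath) :
    T.Between u w v ↔ w ∈ p.support := by
  classical
  refine ⟨fun h => h p, fun h q => ?_⟩
  have : p = q.bypass := (hT.existsUnique_path u v).unique hp q.bypass_isPath
  rw [this] at h
  exact q.support_bypass_subset_support h

theorem IsTree.exists_walk_between (hT : T.IsTree) (u v : V) :
    ∃ p : T.Walk u v, p.IsPath ∧ ∀ w, w ∈ p.support ↔ T.Between u w v := by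
  obtain ⟨p, hp, -⟩ := hT.existsUnique_path u v
  exact ⟨p, hp, fun w => (hT.between_iff hp).symm⟩

theorem IsTree.between_or_between_of_adj (hT : T.IsTree) (h : T.Adj u v) (w : V) :
    T.Between u v w ∨ T.Between v u w := by
  obtain ⟨p, hp, hw⟩ := hT.exists_walk_between v w
  by_cases hu : u ∈ p.support
  · exact Or.inr ((hw u).mp hu)
  · left
    rw [hT.between_iff (hp.cons hu : (Walk.cons h p).IsPath)]
    simp

theorem IsTree.exists_adj_between (hT : T.IsTree) (h : u ≠ v) :
    ∃ d, T.Adj u d ∧ T.Between u d v := by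
  obtain ⟨p, hp, hw⟩ := hT.exists_walk_between u v
  cases p with
  | nil => exact absurd rfl h
  | cons hd q => exact ⟨_, hd, (hw _).mp (by simp)⟩

theorem Connected.adj_between_unique (hT : T.Connected) (hd : T.Adj u d) (he : T.Adj u e)
    (h1 : T.Between u d v) (h2 : T.Between u e v) : d = e := by
  rcases h1.split e with h | h
  · exact (h.eq_or_eq he).resolve_left hd.ne'
  · rcases h2.split d with h' | h'
    · exact ((h'.eq_or_eq hd).resolve_left he.ne').symm
    · exact hT.between_antisymm h.symm h'.symm

theorem Connected.between_of_directions_ne (hT : T.Connected) (hT' : T.IsTree) (hd : T.Adj u d)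
    (he : T.Adj u e) (hde : d ≠ e) (h1 : T.Between u d v) (h2 : T.Between u e w) :
    T.Between v u w := by
  rcases hT'.between_or_between_of_adj hd w with h | h
  · exact absurd (hT.adj_between_unique hd he h h2) hde
  · rcases h.split v with h' | h'
    · exact absurd (hT.between_antisymm h'.symm h1.symm) hd.ne
    · exact h'

theorem Connected.directions_ne_of_between (hT : T.Connected) (hd : T.Adj u d)
    (h1 : T.Between u d v) (h2 : T.Between u d w) : ¬ T.Between v u w := by
  intro h
  rcases h.split d with h' | h'
  · exact hd.ne (hT.between_antisymm h' h1.symm)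
  · exact hd.ne (hT.between_antisymm h'.symm h2.symm)

/-- In a connected graph in which every edge separates each vertex from one of its ends, there is
no cycle. -/
theorem Connected.isTree_of_forall_adj_between (hT : T.Connected)
    (h : ∀ u v w, T.Adj u v → T.Between u v w ∨ T.Between v u w) : T.IsTree := by
  classical
  refine ⟨hT, isAcyclic_iff_subsingleton_path.mpr ?_⟩
  have key : ∀ {u v : V} (p q : T.Walk u v), p.IsPath → q.IsPath → p = q := by
    intro u v p
    induction p with
    | nil =>
      intro q _ hq
      exact (Walk.isPath_iff_nil.mp hq).eq_nil.symm
    | @cons a b c hab p ih =>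
      intro q hp hq
      cases q with
      | nil => simp at hp
      | @cons _ b' _ hab' q =>
        rw [Walk.cons_isPath_iff] at hp hq
        have hb : T.Between a b c := by
          rcases h a b c hab with h' | h'
          · exact h'
          · exact absurd (h' p) hp.2
        have hb' : T.Between a b' c := by
          rcases h a b' c hab' with h' | h'
          · exact h'
          · exact absurd (h' q) hq.2
        obtain rfl := hT.adj_between_unique hab hab' hb hb'
        rw [ih q hp.1 hq.1]
  exact fun v w => ⟨fun p q => Subtype.ext (key p.1 q.1 p.2 q.2)⟩

/-- The vertex set of a subtree. -/
def BetweenClosed (T : SimpleGraph V) (S : Set V) : Prop :=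
  ∀ a ∈ S, ∀ b ∈ S, ∀ w, T.Between a w b → w ∈ S

theorem betweenClosed_of_connected_induce {S : Set V} (h : (T.induce S).Connected) :
    T.BetweenClosed S := by
  intro a ha b hb w hw
  obtain ⟨p⟩ := h.preconnected ⟨a, ha⟩ ⟨b, hb⟩
  obtain ⟨x, -, rfl⟩ := Between.exists_of_hom (Embedding.induce S).toHom hw p
  exact x.2

theorem IsTree.exists_induce_walk (hT : T.IsTree) {S : Set V} (hS : T.BetweenClosed S)
    (a b : S) : ∃ p : (T.induce S).Walk a b, ∀ w : S, w ∈ p.support → T.Between a.1 w.1 b.1 := by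
  obtain ⟨p, hp, hw⟩ := hT.exists_walk_between a.1 b.1
  refine ⟨p.induce S fun w h => hS a.1 a.2 b.1 b.2 w ((hw w).mp h), fun w h => (hw w).mp ?_⟩
  rw [Walk.support_induce] at h
  simpa using h

theorem IsTree.connected_induce (hT : T.IsTree) {S : Set V} (hS : T.BetweenClosed S)
    (hne : S.Nonempty) : (T.induce S).Connected :=
  connected_iff _ |>.mpr ⟨fun a b => ⟨(hT.exists_induce_walk hS a b).choose⟩, hne.to_subtype⟩

theorem IsTree.induce_between_iff (hT : T.IsTree) {S : Set V} (hS : T.BetweenClosed S)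
    (a w b : S) : (T.induce S).Between a w b ↔ T.Between a.1 w.1 b.1 := by
  obtain ⟨p, hp⟩ := hT.exists_induce_walk hS a b
  refine ⟨fun h => hp w (h p), fun h q => ?_⟩
  obtain ⟨x, hx, hxw⟩ := Between.exists_of_hom (Embedding.induce S).toHom h q
  obtain rfl : x = w := Subtype.ext hxw
  exact hx

/-- The union of the paths that join points of `S`. -/
def betweenHull (T : SimpleGraph V) (S : Set V) : Set V :=
  {w | ∃ a ∈ S, ∃ b ∈ S, T.Between a w b}

theorem subset_betweenHull (T : SimpleGraph V) (S : Set V) : S ⊆ T.betweenHull S :=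
  fun a ha => ⟨a, ha, a, ha, Between.left _ _ _⟩

/-- A point between `v` and `v'` lies on one of the three pieces of the detour `v`, `a`, `c`, `v'`,
whose ends `a` and `c` are in `S`. -/
theorem betweenClosed_betweenHull (T : SimpleGraph V) (S : Set V) :
    T.BetweenClosed (T.betweenHull S) := by
  rintro v ⟨a, ha, b, hb, hv⟩ v' ⟨c, hc, d, hd, hv'⟩ x hx
  rcases hx.split a with h | h
  · exact ⟨a, ha, b, hb, hv.trans_left h.symm⟩
  rcases h.split c with h | h
  · exact ⟨a, ha, c, hc, h⟩
  · exact ⟨c, hc, d, hd, hv'.trans_left h⟩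

theorem betweenClosed_segment (T : SimpleGraph V) (u v : V) :
    T.BetweenClosed {w | T.Between u w v} := by
  intro a ha b hb x hx
  rcases hx.split u with h | h
  · exact Between.trans_left ha h.symm
  · exact Between.trans_left hb h

/-- The gate is a point of `S` nearest to `x`. If its first edge towards `x` also led towards some
`s'` in `S`, the next vertex would be in `S` and nearer. -/
theorem IsTree.exists_gate (hT : T.IsTree) {S : Set V} (hS : T.BetweenClosed S)
    (hne : S.Nonempty) (x : V) : ∃ s ∈ S, ∀ s' ∈ S, T.Between x s s' := by
  obtain ⟨s, hs, hmin⟩ := exists_minimalFor_of_wellFoundedLT (· ∈ S) (fun s => T.dist x s) hne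
  refine ⟨s, hs, fun s' hs' => ?_⟩
  by_cases hxs : s = x
  · rw [hxs]; exact Between.left _ _ _
  obtain ⟨d, hd, hd'⟩ := hT.exists_adj_between hxs
  rcases hT.between_or_between_of_adj hd s' with h | h
  · have h1 := hmin (hS s hs s' hs' d h)
    have h2 := hT.connected.dist_add_of_between hd'.symm
    have h3 := hT.connected.pos_dist_of_ne hd.ne'
    have h1 := h1 (by change T.dist x d ≤ T.dist x s; omega)
    change T.dist x s ≤ T.dist x d at h1
    omega
  · rcases h.split x with h' | h'
    · exact absurd (hT.connected.between_antisymm h'.symm hd'.symm) hd.ne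
    · exact h'

/-- The median is the gate of `w` in the path from `u` to `v`. -/
theorem IsTree.exists_median (hT : T.IsTree) (u v w : V) :
    ∃ m, T.Between u m v ∧ T.Between v m w ∧ T.Between w m u := by
  obtain ⟨m, hm, h⟩ := hT.exists_gate (T.betweenClosed_segment u v) ⟨u, Between.left _ _ _⟩ w
  exact ⟨m, hm, (h v (Between.right _ _ _)).symm, h u (Between.left _ _ _)⟩

/-- The vertex `v` has at least three neighbours. -/
def IsBranch (T : SimpleGraph V) (v : V) : Prop :=
  ∃ a b c, T.Adj v a ∧ T.Adj v b ∧ T.Adj v c ∧ a ≠ b ∧ b ≠ c ∧ c ≠ a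

theorem IsTree.isBranch_of_between (hT : T.IsTree) {a b c : V} (ha : a ≠ v) (hb : b ≠ v)
    (hc : c ≠ v) (hab : T.Between a v b) (hbc : T.Between b v c) (hca : T.Between c v a) :
    T.IsBranch v := by
  obtain ⟨a', ha', ha''⟩ := hT.exists_adj_between ha.symm
  obtain ⟨b', hb', hb''⟩ := hT.exists_adj_between hb.symm
  obtain ⟨c', hc', hc''⟩ := hT.exists_adj_between hc.symm
  refine ⟨a', b', c', ha', hb', hc', ?_, ?_, ?_⟩
  · rintro rfl
    exact hT.connected.directions_ne_of_between ha' ha'' hb'' hab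
  · rintro rfl
    exact hT.connected.directions_ne_of_between hb' hb'' hc'' hbc
  · rintro rfl
    exact hT.connected.directions_ne_of_between hc' hc'' ha'' hca

theorem IsBranch.encard_ne_two (h : T.IsBranch v) : (T.neighborSet v).encard ≠ 2 := by
  obtain ⟨a, b, c, ha, hb, hc, hab, hbc, hca⟩ := h
  intro h
  obtain ⟨x, y, -, hxy⟩ := Set.encard_eq_two.mp h
  have ha : a ∈ T.neighborSet v := ha
  have hb : b ∈ T.neighborSet v := hb
  have hc : c ∈ T.neighborSet v := hc
  rw [hxy] at ha hb hc
  simp only [Set.mem_insert_iff, Set.mem_singleton_iff] at ha hb hc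
  grind

theorem isBranch_of_encard_ne_two (ha : T.Adj v a) (hb : T.Adj v b) (hab : a ≠ b)
    (h : (T.neighborSet v).encard ≠ 2) : T.IsBranch v := by
  by_contra hc
  refine h (Set.encard_eq_two.mpr ⟨a, b, hab, Set.Subset.antisymm (fun c hvc => ?_) ?_⟩)
  · by_contra h'
    simp only [Set.mem_insert_iff, Set.mem_singleton_iff, not_or] at h'
    exact hc ⟨a, b, c, ha, hb, hvc, hab, Ne.symm h'.2, h'.1⟩
  · rintro c (rfl | rfl)
    · exact ha
    · exact hb

end Between

end SimpleGraph

/-! ### Minimal free actions on trees -/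

namespace GGraph

section Minimal

variable {G : Type} [Group G] {X : GGraph G}

theorem between_smul {u w v : X.V} (h : X.graph.Between u w v) (g : G) :
    X.graph.Between (g • u) (g • w) (g • v) := by
  intro p
  have h' : X.graph.Between (X.smulHom g⁻¹ (g • u)) w (X.smulHom g⁻¹ (g • v)) := by
    simpa [smulHom] using h
  obtain ⟨x, hx, rfl⟩ := h'.exists_of_hom _ p
  simpa [smulHom] using hx

theorem dist_smul (hX : X.graph.Connected) (g : G) (u v : X.V) :
    X.graph.dist (g • u) (g • v) = X.graph.dist u v := by
  have key : ∀ (g : G) (u v : X.V), X.graph.dist (g • u) (g • v) ≤ X.graph.dist u v := by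
    intro g u v
    obtain ⟨p, hp⟩ := hX.exists_walk_length_eq_dist u v
    rw [← hp, ← SimpleGraph.Walk.length_map (X.smulHom g) p]
    exact SimpleGraph.dist_le _
  exact le_antisymm (key g u v) (by simpa using key g⁻¹ (g • u) (g • v))

theorem dist_mul_smul_le (hX : X.graph.Connected) (g h : G) (x : X.V) :
    X.graph.dist x ((g * h) • x) ≤ X.graph.dist x (g • x) + X.graph.dist x (h • x) := by
  have := hX.dist_triangle (u := x) (v := g • x) (w := g • h • x)
  rwa [dist_smul hX, smul_smul] at this

theorem dist_pow_smul_le (hX : X.graph.Connected) (g : G) (x : X.V) (i : ℕ) :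
    X.graph.dist x (g ^ i • x) ≤ i * X.graph.dist x (g • x) := by
  induction i with
  | zero => simp
  | succ i ih =>
    rw [pow_succ]
    have := dist_mul_smul_le hX (g ^ i) g x
    rw [add_mul, one_mul]
    omega

theorem isInvariantSubtree_iff (hX : X.graph.IsTree) {S : Set X.V} :
    X.IsInvariantSubtree S ↔
      (∀ (g : G), ∀ v ∈ S, g • v ∈ S) ∧ X.graph.BetweenClosed S ∧ S.Nonempty := by
  refine and_congr_right fun _ => ⟨fun h => ⟨SimpleGraph.betweenClosed_of_connected_induce h, ?_⟩,
    fun h => hX.connected_induce h.1 h.2⟩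
  exact Set.nonempty_coe_sort.mp h.nonempty

theorem isInvariantSubtree_betweenHull (hX : X.graph.IsTree) {S : Set X.V}
    (hS : ∀ (g : G), ∀ v ∈ S, g • v ∈ S) (hne : S.Nonempty) :
    X.IsInvariantSubtree (X.graph.betweenHull S) := by
  refine (isInvariantSubtree_iff hX).mpr ⟨?_, SimpleGraph.betweenClosed_betweenHull _ _,
    hne.mono (SimpleGraph.subset_betweenHull _ _)⟩
  rintro g v ⟨a, ha, b, hb, h⟩
  exact ⟨g • a, hS g a ha, g • b, hS g b hb, between_smul h g⟩

theorem IsMinimal.exists_between (hm : X.IsMinimal) (hX : X.graph.IsTree) {S : Set X.V}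
    (hS : ∀ (g : G), ∀ v ∈ S, g • v ∈ S) (hne : S.Nonempty) (w : X.V) :
    ∃ a ∈ S, ∃ b ∈ S, X.graph.Between a w b := by
  have := hm _ (isInvariantSubtree_betweenHull hX hS hne)
  have hw : w ∈ X.graph.betweenHull S := this ▸ Set.mem_univ w
  exact hw

/-- In every direction at `a` there is a translate of `a`. -/
theorem IsMinimal.exists_between_smul (hm : X.IsMinimal) (hX : X.graph.IsTree) (a d : X.V) :
    ∃ g : G, X.graph.Between a d (g • a) := by
  obtain ⟨_, ⟨g, rfl⟩, _, ⟨h, rfl⟩, hw⟩ := hm.exists_between hX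
    (S := Set.range fun g : G => g • a) (by rintro g _ ⟨h, rfl⟩; exact ⟨g * h, mul_smul _ _ _⟩)
    ⟨_, 1, rfl⟩ d
  rcases hw.split a with h' | h'
  · exact ⟨g, h'.symm⟩
  · exact ⟨h, h'⟩

/-- A vertex of minimal displacement lies in each invariant subtree. -/
theorem minimalSubtree_nonempty [Nontrivial G] (hX : X.graph.IsTree) (hf : X.IsFree) :
    X.minimalSubtree.Nonempty := by
  obtain ⟨g, hg⟩ := exists_ne (1 : G)
  have := hX.connected.nonempty
  obtain ⟨x, -, hmin⟩ := exists_minimalFor_of_wellFoundedLT (fun _ : X.V => True)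
    (fun x => X.graph.dist x (g • x)) ⟨Classical.arbitrary X.V, trivial⟩
  refine ⟨x, fun S hS => ?_⟩
  obtain ⟨hS, hc, hne⟩ := (isInvariantSubtree_iff hX).mp hS
  obtain ⟨y, hy, hgate⟩ := hX.exists_gate hc hne x
  by_contra hx
  have hgy : X.graph.Between x y (g • y) := hgate _ (hS g y hy)
  have hgate' : ∀ s ∈ S, X.graph.Between (g • x) (g • y) s := fun s hs => by
    simpa using between_smul (hgate _ (hS g⁻¹ s hs)) g
  -- The path from `x` to `g • x` runs through the gates `y` and `g • y`, so its length is `2 * dist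
  -- x y + dist y (g • y)`, contrary to the minimality of the displacement of `x`.
  have h1 : X.graph.Between x y (g • x) := by
    rcases hgy.split (g • x) with h | h
    · exact h
    · exact absurd (hX.connected.between_antisymm h (hgate' y hy)).symm fun h => hg (hf g y h)
  have h2 := hX.connected.dist_add_of_between h1
  have h3 := hX.connected.dist_add_of_between (hgate' y hy)
  have h4 : 0 < X.graph.dist x y := hX.connected.pos_dist_of_ne (by rintro rfl; exact hx hy)
  have h5 : X.graph.dist x (g • x) ≤ X.graph.dist y (g • y) := by
    by_contra hlt
    exact hlt (hmin (j := y) trivial (by change X.graph.dist y _ ≤ X.graph.dist x _; omega))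
  rw [SimpleGraph.dist_comm (u := y) (v := g • x)] at h2
  rw [SimpleGraph.dist_comm (u := g • y) (v := y)] at h3
  have h6 := dist_smul hX.connected g x y
  omega

theorem isInvariantSubtree_minimalSubtree [Nontrivial G] (hX : X.graph.IsTree) (hf : X.IsFree) :
    X.IsInvariantSubtree X.minimalSubtree := by
  refine (isInvariantSubtree_iff hX).mpr ⟨fun g v hv S hS => hS.1 g v (hv S hS), ?_,
    minimalSubtree_nonempty hX hf⟩
  intro a ha b hb w hw S hS
  exact ((isInvariantSubtree_iff hX).mp hS).2.1 a (ha S hS) b (hb S hS) w hw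

theorem minimalSubtree_subset {S : Set X.V} (hS : X.IsInvariantSubtree S) :
    X.minimalSubtree ⊆ S := fun _ h => h S hS

/-- A minimal free action on a tree. -/
structure IsMinimalFreeTree (X : GGraph G) : Prop where
  isTree : X.graph.IsTree
  isFree : X.IsFree
  isMinimal : X.IsMinimal

theorem betweenClosed_minimalSubtree [Nontrivial G] (hX : X.graph.IsTree) (hf : X.IsFree) :
    X.graph.BetweenClosed X.minimalSubtree :=
  SimpleGraph.betweenClosed_of_connected_induce (isInvariantSubtree_minimalSubtree hX hf).2

/-- An invariant subtree of the core is also one of `X`, hence contains the core. -/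
theorem isMinimalFreeTree_core [Nontrivial G] (hX : X.graph.IsTree) (hf : X.IsFree) :
    X.core.IsMinimalFreeTree := by
  have hc := betweenClosed_minimalSubtree hX hf
  have hT : X.core.graph.IsTree :=
    ⟨(isInvariantSubtree_minimalSubtree hX hf).2, hX.isAcyclic.induce _⟩
  refine ⟨hT, fun g v h => hf g v.1 (congrArg Subtype.val h), fun S hS => ?_⟩
  obtain ⟨h1, h2, h3⟩ := (isInvariantSubtree_iff hT).mp hS
  have : X.IsInvariantSubtree (Subtype.val '' S) := by
    refine (isInvariantSubtree_iff hX).mpr ⟨?_, ?_, h3.image _⟩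
    · rintro g _ ⟨v, hv, rfl⟩
      exact ⟨_, h1 g v hv, rfl⟩
    · rintro _ ⟨a, ha, rfl⟩ _ ⟨b, hb, rfl⟩ w hw
      have hw' := hc a.1 a.2 b.1 b.2 w hw
      exact ⟨⟨w, hw'⟩, h2 a ha b hb ⟨w, hw'⟩ ((hX.induce_between_iff hc a ⟨w, hw'⟩ b).mpr hw), rfl⟩
  refine Set.eq_univ_of_forall fun v => ?_
  obtain ⟨w, hw, hwv⟩ := minimalSubtree_subset this v.2
  rwa [← Subtype.ext hwv]

theorem isFree_comap {H : Type} [Group H] {f : H →* G} (hf : Function.Injective f)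
    (hX : X.IsFree) : (X.comap f).IsFree :=
  fun h v hv => (map_eq_one_iff f hf).mp (hX (f h) v hv)

/-- In a minimal free action, a vertex of valence different from 2 has valence at least 3. -/
theorem IsMinimalFreeTree.valence_ne_two_iff [Nontrivial G] [IsMulTorsionFree G]
    (h : X.IsMinimalFreeTree) (v : X.V) : X.valence v ≠ 2 ↔ X.graph.IsBranch v := by
  refine ⟨fun hv => ?_, fun hb => hb.encard_ne_two⟩
  obtain ⟨g, hg⟩ := exists_ne (1 : G)
  obtain ⟨w, hvw, -⟩ := h.isTree.exists_adj_between (u := v) (v := g • v)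
    fun h' => hg (h.isFree g v h'.symm)
  -- A translate of `w` at or beyond `v` provides a second neighbour of `v`. If `v` itself is the
  -- translate `k • w`, this neighbour is `k • v`; were it equal to `w`, then `k` would invert an
  -- edge and `k ^ 2 = 1`.
  obtain ⟨k, hk⟩ := h.isMinimal.exists_between_smul h.isTree w v
  by_cases hkv : v = k • w
  · have h1 : X.graph.Adj v (k • v) := by
      have := X.smul_adj k v w hvw
      rw [← hkv] at this
      exact this.symm
    refine SimpleGraph.isBranch_of_encard_ne_two hvw h1 ?_ hv
    intro he
    have h2 : (k ^ 2) • v = v := by rw [pow_two, mul_smul, ← he, ← hkv]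
    have h3 := h.isFree _ _ h2
    rw [pow_eq_one_iff_left two_ne_zero] at h3
    rw [h3, one_smul] at hkv
    exact hvw.ne hkv
  · obtain ⟨e, he, he'⟩ := h.isTree.exists_adj_between hkv
    refine SimpleGraph.isBranch_of_encard_ne_two hvw he ?_ hv
    rintro rfl
    exact h.isTree.connected.directions_ne_of_between hvw (SimpleGraph.Between.right _ _ _) he' hk

end Minimal

/-! ### Existence of branch vertices in rank at least 2 -/

section Line

variable {n : ℕ}

theorem nontrivial_freeGroup_fin (hn : 2 ≤ n) : Nontrivial (FreeGroup (Fin n)) :=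
  ⟨FreeGroup.of ⟨0, by omega⟩, 1, FreeGroup.of_ne_one _⟩

/-- Without branch vertices the tree is part of a line, where distance from `x` and side of `x` are
coordinates. Indeed `y` and `z` leave `x` by the same edge, and their median with `x` would be a
branch vertex unless it is `y` or `z`. -/
theorem eq_of_dist_eq_of_not_isBranch {V : Type*} {T : SimpleGraph V} (hT : T.IsTree)
    (hb : ∀ v, ¬ T.IsBranch v) {x u y z : V} (hu : T.Adj x u) (hd : T.dist x y = T.dist x z)
    (h : T.Between x u y ↔ T.Between x u z) : y = z := by
  have hc := hT.connected
  by_cases hy : x = y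
  · subst hy
    rw [SimpleGraph.dist_self] at hd
    exact hc.dist_eq_zero_iff.mp hd.symm
  by_cases hz : x = z
  · subst hz
    rw [SimpleGraph.dist_self] at hd
    exact (hc.dist_eq_zero_iff.mp hd).symm
  have key : ∃ d, T.Adj x d ∧ T.Between x d y ∧ T.Between x d z := by
    by_cases hxy : T.Between x u y
    · exact ⟨u, hu, hxy, h.mp hxy⟩
    obtain ⟨d, hd, hd'⟩ := hT.exists_adj_between hy
    obtain ⟨e, he, he'⟩ := hT.exists_adj_between hz
    by_cases hde : d = e
    · exact ⟨d, hd, hd', hde ▸ he'⟩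
    · refine absurd ⟨u, d, e, hu, hd, he, ?_, hde, ?_⟩ (hb x)
      · rintro rfl; exact hxy hd'
      · rintro rfl; exact hxy (h.mpr he')
  obtain ⟨d, hxd, hdy, hdz⟩ := key
  obtain ⟨m, h1, h2, h3⟩ := hT.exists_median x y z
  have hmx : x ≠ m := by
    rintro rfl
    exact hc.directions_ne_of_between hxd hdy hdz h2
  by_cases hmy : y = m
  · subst hmy
    have := hc.dist_add_of_between h3.symm
    exact hc.dist_eq_zero_iff.mp (by omega)
  by_cases hmz : z = m
  · subst hmz
    have := hc.dist_add_of_between h1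
    exact (hc.dist_eq_zero_iff.mp (by omega)).symm
  exact absurd (hT.isBranch_of_between hmx hmy hmz h1 h2 h3) (hb m)

/-- The exponents are recovered as the exponent sums of `a` and of `b`. -/
theorem pow_mul_pow_injective {a b : Fin n} (hab : a ≠ b) {i j k l : ℕ}
    (h : FreeGroup.of a ^ i * FreeGroup.of b ^ j = FreeGroup.of a ^ k * FreeGroup.of b ^ l) :
    i = k ∧ j = l := by
  have key (c : Fin n) := congrArg (FreeGroup.lift
    fun x => if x = c then Multiplicative.ofAdd (1 : ℤ) else 1) h
  have h1 := key a
  have h2 := key b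
  simp only [map_mul, map_pow, FreeGroup.lift_apply_of, hab.symm, hab, if_true, if_false, one_pow,
    mul_one, one_mul, ← ofAdd_nsmul, EmbeddingLike.apply_eq_iff_eq, nsmul_eq_mul] at h1 h2
  exact ⟨by exact_mod_cast h1, by exact_mod_cast h2⟩

/-- A free group of rank at least 2 does not act freely on a line. -/
theorem exists_isBranch (hn : 2 ≤ n) {X : GGraph (FreeGroup (Fin n))} (hX : X.graph.IsTree)
    (hf : X.IsFree) : ∃ v, X.graph.IsBranch v := by
  classical
  by_contra! hb
  have hc := hX.connected
  obtain ⟨x⟩ := hc.nonempty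
  set a : Fin n := ⟨0, by omega⟩
  set b : Fin n := ⟨1, by omega⟩
  have hab : a ≠ b := by simp [a, b]
  obtain ⟨u, hu, -⟩ := hX.exists_adj_between (u := x) (v := FreeGroup.of a • x)
    fun h => FreeGroup.of_ne_one a (hf _ _ h.symm)
  set C := X.graph.dist x (FreeGroup.of a • x) + X.graph.dist x (FreeGroup.of b • x) with hC
  -- The `N * N` elements `a ^ i * b ^ j` with `i, j < N` move `x` by at most `N * C`, while a line
  -- has room for at most `2 * (N * C + 1)` pairs of a distance and a side. This choice of `N` gives
  -- `N * N = 2 * N * C + 3 * N`, which is larger.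
  set N := 2 * C + 3
  let γ : Fin N × Fin N → FreeGroup (Fin n) :=
    fun q => FreeGroup.of a ^ (q.1 : ℕ) * FreeGroup.of b ^ (q.2 : ℕ)
  have hγ : Function.Injective γ := fun q r h => by
    obtain ⟨h1, h2⟩ := pow_mul_pow_injective hab h
    exact Prod.ext (Fin.ext h1) (Fin.ext h2)
  have hdist : ∀ q, X.graph.dist x (γ q • x) < N * C + 1 := fun q => by
    have h0 := dist_mul_smul_le hc (FreeGroup.of a ^ (q.1 : ℕ)) (FreeGroup.of b ^ (q.2 : ℕ)) x
    have h1 := dist_pow_smul_le hc (FreeGroup.of a) x q.1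
    have h2 := dist_pow_smul_le hc (FreeGroup.of b) x q.2
    have h3 := Nat.mul_le_mul_right (X.graph.dist x (FreeGroup.of a • x)) q.1.2.le
    have h4 := Nat.mul_le_mul_right (X.graph.dist x (FreeGroup.of b • x)) q.2.2.le
    rw [hC, mul_add]
    change X.graph.dist x ((_ * _) • x) < _
    omega
  let code : Fin N × Fin N → Fin (N * C + 1) × Bool :=
    fun q => (⟨X.graph.dist x (γ q • x), hdist q⟩, decide (X.graph.Between x u (γ q • x)))
  have hcode : Function.Injective code := fun q r h => by
    simp only [code, Prod.mk.injEq, Fin.mk.injEq, decide_eq_decide] at h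
    have h1 := eq_of_dist_eq_of_not_isBranch hX hb hu h.1 h.2
    have h2 := hf ((γ r)⁻¹ * γ q) x (by rw [mul_smul, h1, inv_smul_smul])
    exact hγ (inv_mul_eq_one.mp h2).symm
  have := Fintype.card_le_of_injective code hcode
  simp only [Fintype.card_prod, Fintype.card_fin, Fintype.card_bool] at this
  have hN : N * N = 2 * (N * C) + 3 * N := by simp only [N]; ring
  omega

/-- A minimal tree is the union of the paths between its vertices of valence at least 3. -/
theorem IsMinimalFreeTree.exists_between_isBranch (hn : 2 ≤ n) {X : GGraph (FreeGroup (Fin n))}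
    (h : X.IsMinimalFreeTree) (w : X.V) :
    ∃ a, X.graph.IsBranch a ∧ ∃ b, X.graph.IsBranch b ∧ X.graph.Between a w b := by
  refine h.isMinimal.exists_between h.isTree (S := {v | X.graph.IsBranch v}) ?_
    (exists_isBranch hn h.isTree h.isFree) w
  rintro g v ⟨a, b, c, ha, hb, hc, hab, hbc, hca⟩
  exact ⟨g • a, g • b, g • c, X.smul_adj g _ _ ha, X.smul_adj g _ _ hb, X.smul_adj g _ _ hc,
    by simpa, by simpa, by simpa⟩

end Line

end GGraph

/-! ### Erasing the vertices of valence 2 -/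

namespace GGraph

section Erase

variable {G : Type} [Group G] {X : GGraph G}

theorem valence_ne_two_of_isBranch {v : X.V} (h : X.graph.IsBranch v) : X.valence v ≠ 2 :=
  h.encard_ne_two

theorem erase_adj_iff (hX : X.graph.IsTree) (u v : X.erase.V) :
    X.erase.graph.Adj u v ↔
      u ≠ v ∧ ∀ w : X.erase.V, X.graph.Between u.1 w.1 v.1 → w = u ∨ w = v := by
  refine and_congr_right fun _ => ⟨?_, fun h => ?_⟩
  · rintro ⟨p, hp, hw⟩ w h
    by_contra! hne
    exact w.2 (hw w.1 (h p) (fun h => hne.1 (Subtype.ext h)) (fun h => hne.2 (Subtype.ext h)))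
  · obtain ⟨p, hp, hw⟩ := hX.exists_walk_between u.1 v.1
    refine ⟨p, hp, fun w hwp hu hv => ?_⟩
    by_contra h2
    rcases h ⟨w, h2⟩ ((hw w).mp hwp) with h | h
    · exact hu (congrArg Subtype.val h)
    · exact hv (congrArg Subtype.val h)

/-- Two different remaining vertices that are not adjacent have a remaining vertex strictly between
them, so induction on the distance applies. -/
theorem exists_erase_walk (hX : X.graph.IsTree) (u v : X.erase.V) :
    ∃ p : X.erase.graph.Walk u v, ∀ w ∈ p.support, X.graph.Between u.1 w.1 v.1 := by
  induction hk : X.graph.dist u.1 v.1 using Nat.strong_induction_on generalizing u v with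
  | _ k ih =>
  by_cases huv : u = v
  · subst huv
    refine ⟨.nil, fun w hw => ?_⟩
    rw [SimpleGraph.Walk.support_nil, List.mem_singleton] at hw
    subst hw
    exact SimpleGraph.Between.left _ _ _
  by_cases ha : X.erase.graph.Adj u v
  · refine ⟨ha.toWalk, fun w hw => ?_⟩
    have hw : w = u ∨ w = v := by simpa using hw
    rcases hw with rfl | rfl
    · exact SimpleGraph.Between.left _ _ _
    · exact SimpleGraph.Between.right _ _ _
  · rw [erase_adj_iff hX] at ha
    push Not at ha
    obtain ⟨w, hw, hwu, hwv⟩ := ha huv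
    have h1 := hX.connected.dist_add_of_between hw
    have h2 := hX.connected.pos_dist_of_ne fun h => hwu (Subtype.ext h).symm
    have h3 := hX.connected.pos_dist_of_ne fun h => hwv (Subtype.ext h)
    obtain ⟨p, hp⟩ := ih _ (by omega) u w rfl
    obtain ⟨q, hq⟩ := ih _ (by omega) w v rfl
    refine ⟨p.append q, fun x hx => ?_⟩
    rcases SimpleGraph.Walk.mem_support_append_iff .. |>.mp hx with h | h
    · exact hw.trans_left (hp x h)
    · exact hw.trans_right (hq x h)

theorem erase_between_iff (hX : X.graph.IsTree) (u w v : X.erase.V) :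
    X.erase.graph.Between u w v ↔ X.graph.Between u.1 w.1 v.1 := by
  refine ⟨fun h => ?_, fun h p => ?_⟩
  · obtain ⟨p, hp⟩ := exists_erase_walk hX u v
    exact hp w (h p)
  · induction p with
    | nil => exact List.mem_singleton.mpr (Subtype.ext h.eq)
    | @cons a b c hab p ih =>
      rw [SimpleGraph.Walk.support_cons, List.mem_cons]
      rcases h.split b.1 with h | h
      · rcases ((erase_adj_iff hX a b).mp hab).2 w h with rfl | rfl
        · exact Or.inl rfl
        · exact Or.inr p.start_mem_support
      · exact Or.inr (ih h)

/-- The median of `u`, `v`, `w` is one of them or a branch vertex, so it is never erased; lying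
between adjacent `u` and `v`, it must be one of these two. -/
theorem between_or_between_of_erase_adj (hX : X.graph.IsTree) {u v : X.erase.V}
    (h : X.erase.graph.Adj u v) (w : X.erase.V) :
    X.graph.Between u.1 v.1 w.1 ∨ X.graph.Between v.1 u.1 w.1 := by
  obtain ⟨m, h1, h2, h3⟩ := hX.exists_median u.1 v.1 w.1
  by_cases hmu : u.1 = m
  · right; rwa [hmu]
  by_cases hmv : v.1 = m
  · left; rw [hmv]; exact h3.symm
  have hm : X.valence m ≠ 2 := by
    by_cases hmw : w.1 = m
    · rw [← hmw]; exact w.2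
    · exact valence_ne_two_of_isBranch (hX.isBranch_of_between hmu hmv hmw h1 h2 h3)
  rcases ((erase_adj_iff hX u v).mp h).2 ⟨m, hm⟩ h1 with h | h
  · exact absurd (congrArg Subtype.val h).symm hmu
  · exact absurd (congrArg Subtype.val h).symm hmv

/-- The tree is the union of the paths between its vertices of valence different from 2. -/
def IsErasable (X : GGraph G) : Prop :=
  ∀ w : X.V, ∃ a b : X.erase.V, X.graph.Between a.1 w b.1

theorem isTree_erase (hX : X.graph.IsTree) (he : X.IsErasable) : X.erase.graph.IsTree := by
  have hne : Nonempty X.erase.V :=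
    ⟨(he (Classical.choice hX.connected.nonempty)).choose⟩
  have hc : X.erase.graph.Connected :=
    (SimpleGraph.connected_iff _).mpr ⟨fun u v => ⟨(exists_erase_walk hX u v).choose⟩, hne⟩
  refine hc.isTree_of_forall_adj_between fun u v w h => ?_
  rw [erase_between_iff hX, erase_between_iff hX]
  exact between_or_between_of_erase_adj hX h w

/-- Sending a neighbour in the erased tree to the first vertex of `X` on the way to it is a
bijection of neighbour sets. It is onto because erasability puts a remaining vertex in every
direction. -/
theorem valence_erase (hX : X.graph.IsTree) (he : X.IsErasable) (a : X.erase.V) :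
    X.erase.valence a = X.valence a.1 := by
  have hc := hX.connected
  have hex : ∀ b : X.erase.graph.neighborSet a, ∃ d : X.graph.neighborSet a.1,
      X.graph.Between a.1 d.1 b.1.1 := fun b => by
    obtain ⟨d, hd, hd'⟩ := hX.exists_adj_between (u := a.1) (v := b.1.1)
      fun h => (show X.erase.graph.Adj a b.1 from b.2).ne (Subtype.ext h)
    exact ⟨⟨d, hd⟩, hd'⟩
  choose f hf using hex
  refine Set.encard_congr (Equiv.ofBijective f ⟨fun b b' hbb => ?_, fun d => ?_⟩)
  · have hb := (erase_adj_iff hX a b.1).mp b.2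
    have hb' := (erase_adj_iff hX a b'.1).mp b'.2
    have h1 := hf b
    have h2 := hf b'
    rw [← hbb] at h2
    rcases between_or_between_of_erase_adj hX (show X.erase.graph.Adj a b.1 from b.2) b'.1 with
      h | h
    · exact Subtype.ext ((hb'.2 b.1 h).resolve_left hb.1.symm)
    · exact absurd h (hc.directions_ne_of_between (f b).2 h1 h2)
  · obtain ⟨c, c', hcc⟩ := he d.1
    have : ∃ c : X.erase.V, X.graph.Between a.1 d.1 c.1 := by
      rcases hcc.split a.1 with h | h
      · exact ⟨c, h.symm⟩
      · exact ⟨c', h⟩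
    obtain ⟨c, hac⟩ := this
    have hne : a ≠ c := by
      rintro rfl
      exact (show X.graph.Adj a.1 d.1 from d.2).ne hac.eq.symm
    obtain ⟨b, hb, hb'⟩ := (isTree_erase hX he).exists_adj_between hne
    rw [erase_between_iff hX] at hb'
    refine ⟨⟨b, hb⟩, Subtype.ext ?_⟩
    exact hc.adj_between_unique (f ⟨b, hb⟩).2 d.2 (hb'.trans_left (hf ⟨b, hb⟩)) hac

theorem isFree_erase (hf : X.IsFree) : X.erase.IsFree :=
  fun g v h => hf g v.1 (congrArg Subtype.val h)

theorem isMinimal_erase (hX : X.graph.IsTree) (he : X.IsErasable) (hm : X.IsMinimal) :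
    X.erase.IsMinimal := by
  intro S hS
  obtain ⟨h1, h2, h3⟩ := (isInvariantSubtree_iff (isTree_erase hX he)).mp hS
  refine Set.eq_univ_of_forall fun a => ?_
  obtain ⟨_, ⟨s, hs, rfl⟩, _, ⟨t, ht, rfl⟩, hst⟩ :=
    hm.exists_between hX (S := Subtype.val '' S)
    (by rintro g _ ⟨v, hv, rfl⟩; exact ⟨_, h1 g v hv, rfl⟩) (h3.image _) a.1
  exact h2 s hs t ht a ((erase_between_iff hX s a t).mpr hst)

theorem IsMinimalFreeTree.isErasable {n : ℕ} (hn : 2 ≤ n) {X : GGraph (FreeGroup (Fin n))}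
    (h : X.IsMinimalFreeTree) : X.IsErasable := fun w => by
  obtain ⟨a, ha, b, hb, hab⟩ := h.exists_between_isBranch hn w
  exact ⟨⟨a, valence_ne_two_of_isBranch ha⟩, ⟨b, valence_ne_two_of_isBranch hb⟩, hab⟩

theorem IsMinimalFreeTree.erase {n : ℕ} (hn : 2 ≤ n) {X : GGraph (FreeGroup (Fin n))}
    (h : X.IsMinimalFreeTree) : X.erase.IsMinimalFreeTree :=
  ⟨isTree_erase h.isTree (h.isErasable hn), isFree_erase h.isFree,
    isMinimal_erase h.isTree (h.isErasable hn) h.isMinimal⟩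

/-- The vertex of the spine of Outer space that is represented by a minimal free tree. -/
def IsMinimalFreeTree.toOuterTree {n : ℕ} (hn : 2 ≤ n) {X : GGraph (FreeGroup (Fin n))}
    (h : X.IsMinimalFreeTree) : OuterTree n where
  X := X.erase
  isTree := (h.erase hn).isTree
  isFree := (h.erase hn).isFree
  isMinimal := (h.erase hn).isMinimal
  valence_ne v := by
    rw [valence_erase h.isTree (h.isErasable hn)]
    exact v.2

end Erase

end GGraph

/-! ### Forest collapses -/

namespace GGraph

section Collapse

variable {G : Type} [Group G] {X Y : GGraph G} {f : X.V → Y.V}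

/-- `f` collapses its fibres, which are connected, to points. -/
structure IsCollapse (X Y : GGraph G) (f : X.V → Y.V) : Prop where
  map_smul : ∀ (g : G) (v : X.V), f (g • v) = g • f v
  surjective : Function.Surjective f
  exists_walk : ∀ u v, f u = f v → ∃ p : X.graph.Walk u v, ∀ w ∈ p.support, f w = f u
  adj_iff : ∀ a b : Y.V, Y.graph.Adj a b ↔
    a ≠ b ∧ ∃ u v : X.V, f u = a ∧ f v = b ∧ X.graph.Adj u v

theorem IsForestCollapse.isCollapse (h : X.IsForestCollapse Y f) : X.IsCollapse Y f := by
  obtain ⟨F, hF, -, -, h1, h2, h3, h4⟩ := h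
  refine ⟨h1, h2, fun u v huv => ?_, h4⟩
  obtain ⟨p⟩ := (h3 u v).mp huv
  refine ⟨p.mapLe hF, fun w hw => ?_⟩
  classical
  replace hw : w ∈ p.support := by simpa using hw
  exact ((h3 u w).mpr ⟨p.takeUntil w hw⟩).symm

/-- The forest consists of all edges inside fibres. An element that carries a vertex into its own
component fixes the image of that vertex in `Y`, hence is trivial. -/
theorem IsCollapse.isForestCollapse (h : X.IsCollapse Y f) (hY : Y.IsFree) :
    X.IsForestCollapse Y f := by
  let F : SimpleGraph X.V :=
    { Adj := fun u v => X.graph.Adj u v ∧ f u = f v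
      symm := ⟨fun u v h => ⟨h.1.symm, h.2.symm⟩⟩
      loopless := ⟨fun u h => h.1.ne rfl⟩ }
  have h1 : ∀ u v, F.Reachable u v → f u = f v := by
    rintro u v ⟨p⟩
    induction p with
    | nil => rfl
    | cons hab p ih => exact hab.2.trans ih
  have h2 : ∀ {u v} (p : X.graph.Walk u v), (∀ w ∈ p.support, f w = f u) → F.Reachable u v := by
    intro u v p
    induction p with
    | nil => exact fun _ => SimpleGraph.Reachable.refl _
    | @cons a b c hab p ih =>
      intro hp
      have hb : f b = f a := hp b (by simp)
      have : F.Adj a b := ⟨hab, hb.symm⟩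
      exact this.reachable.trans (ih fun w hw => (hp w (by simp [hw])).trans hb.symm)
  refine ⟨F, fun u v h => h.1, fun g u v h' => ⟨X.smul_adj g u v h'.1, ?_⟩, fun g u hu => ?_,
    h.map_smul, h.surjective, fun u v => ⟨fun huv => ?_, h1 u v⟩, h.adj_iff⟩
  · rw [h.map_smul, h.map_smul, h'.2]
  · have := h1 _ _ hu
    rw [h.map_smul] at this
    exact hY g _ this.symm
  · obtain ⟨p, hp⟩ := h.exists_walk u v huv
    exact h2 p hp

theorem isCollapse_of_iso (e : X.graph ≃g Y.graph) (he : IsEquivariantIso X Y e) :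
    X.IsCollapse Y e := by
  refine ⟨he, e.surjective, fun u v h => ?_, fun a b => ⟨fun h => ⟨h.ne, e.symm a, e.symm b, ?_⟩,
    ?_⟩⟩
  · obtain rfl := e.injective h
    exact ⟨.nil, by simp⟩
  · exact ⟨e.apply_symm_apply a, e.apply_symm_apply b, e.symm.map_adj_iff.mpr h⟩
  · rintro ⟨-, u, v, rfl, rfl, h⟩
    exact e.map_adj_iff.mpr h

theorem IsCollapse.exists_iso (h : X.IsCollapse Y f) (hf : Function.Injective f) :
    ∃ e : X.graph ≃g Y.graph, IsEquivariantIso X Y e ∧ ⇑e = f := by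
  refine ⟨⟨Equiv.ofBijective f ⟨hf, h.surjective⟩, fun {u v} => ?_⟩, h.map_smul, rfl⟩
  change Y.graph.Adj (f u) (f v) ↔ _
  rw [h.adj_iff]
  constructor
  · rintro ⟨-, u', v', hu, hv, h⟩
    rwa [← hf hu, ← hf hv]
  · exact fun h => ⟨hf.ne h.ne, u, v, rfl, rfl, h⟩

theorem IsCollapse.comap {H : Type} [Group H] (φ : H →* G) (h : X.IsCollapse Y f) :
    (X.comap φ).IsCollapse (Y.comap φ) f :=
  ⟨fun g v => h.map_smul (φ g) v, h.surjective, h.exists_walk, h.adj_iff⟩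

theorem IsCollapse.map_eq_of_between (h : X.IsCollapse Y f) {u v w : X.V} (huv : f u = f v)
    (hw : X.graph.Between u w v) : f w = f u := by
  obtain ⟨p, hp⟩ := h.exists_walk u v huv
  exact hp w (hw p)

/-- A walk in `Y` lifts edge by edge, and the gaps between the lifted edges are filled inside the
connected fibres. So `w` lies in one of the fibres visited. -/
theorem IsCollapse.map_between (h : X.IsCollapse Y f) {u v w : X.V}
    (hw : X.graph.Between u w v) : Y.graph.Between (f u) (f w) (f v) := by
  have key : ∀ {a b : Y.V} (p : Y.graph.Walk a b) (u v : X.V), f u = a → f v = b →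
      X.graph.Between u w v → f w ∈ p.support := by
    intro a b p
    induction p with
    | nil =>
      intro u v hu hv hw
      rw [h.map_eq_of_between (hu.trans hv.symm) hw, hu]
      simp
    | @cons a b c hab p ih =>
      intro u v hu hv hw
      obtain ⟨-, x, y, hx, hy, hxy⟩ := (h.adj_iff a b).mp hab
      rw [SimpleGraph.Walk.support_cons, List.mem_cons]
      rcases hw.split x with hw | hw
      · exact Or.inl ((h.map_eq_of_between (hu.trans hx.symm) hw).trans hu)
      rcases hw.split y with hw | hw
      · rcases hw.eq_or_eq hxy with rfl | rfl
        · exact Or.inl hx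
        · right; rw [hy]; exact p.start_mem_support
      · exact Or.inr (ih y v hy hv hw)
  exact fun p => key p u v rfl rfl hw

theorem IsCollapse.adj_or_eq (h : X.IsCollapse Y f) {u v : X.V} (huv : X.graph.Adj u v) :
    f u = f v ∨ Y.graph.Adj (f u) (f v) := by
  by_cases he : f u = f v
  · exact Or.inl he
  · exact Or.inr ((h.adj_iff _ _).mpr ⟨he, u, v, rfl, rfl, huv⟩)

theorem IsCollapse.isInvariantSubtree_image (h : X.IsCollapse Y f) (hX : X.graph.IsTree) {S : Set X.V}
    (hS : X.IsInvariantSubtree S) : Y.IsInvariantSubtree (f '' S) := by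
  obtain ⟨h1, h2, h3⟩ := (isInvariantSubtree_iff hX).mp hS
  refine ⟨?_, (SimpleGraph.connected_iff _).mpr ⟨?_, (h3.image f).to_subtype⟩⟩
  · rintro g _ ⟨v, hv, rfl⟩
    exact ⟨g • v, h1 g v hv, h.map_smul g v⟩
  · have key : ∀ {u v : S} (p : (X.graph.induce S).Walk u v),
        (Y.graph.induce (f '' S)).Reachable ⟨f u, u, u.2, rfl⟩ ⟨f v, v, v.2, rfl⟩ := by
      intro u v p
      induction p with
      | nil => exact SimpleGraph.Reachable.refl _
      | @cons a b c hab p ih =>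
        refine SimpleGraph.Reachable.trans ?_ ih
        rcases h.adj_or_eq hab with he | he
        · rw [show (⟨f a, a, a.2, rfl⟩ : f '' S) = ⟨f b, b, b.2, rfl⟩ from Subtype.ext he]
        · exact SimpleGraph.Adj.reachable he
    rintro ⟨_, u, hu, rfl⟩ ⟨_, v, hv, rfl⟩
    obtain ⟨p⟩ := hS.2.preconnected ⟨u, hu⟩ ⟨v, hv⟩
    exact key p

theorem IsCollapse.isInvariantSubtree_preimage (h : X.IsCollapse Y f) (hX : X.graph.IsTree)
    (hY : Y.graph.IsTree) {S : Set Y.V} (hS : Y.IsInvariantSubtree S) :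
    X.IsInvariantSubtree (f ⁻¹' S) := by
  obtain ⟨h1, h2, h3⟩ := (isInvariantSubtree_iff hY).mp hS
  refine (isInvariantSubtree_iff hX).mpr ⟨fun g v hv => ?_, fun a ha b hb w hw => ?_,
    h3.preimage h.surjective⟩
  · rw [Set.mem_preimage, h.map_smul]
    exact h1 g _ hv
  · exact h2 _ ha _ hb _ (h.map_between hw)

/-- The preimage of the core of `Y` is an invariant subtree, hence contains the core of `X`; the
image of the core of `X` is one too, hence contains the core of `Y`. -/
theorem IsCollapse.exists_core [Nontrivial G] (h : X.IsCollapse Y f) (hX : X.graph.IsTree)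
    (hXf : X.IsFree) (hY : Y.graph.IsTree) (hYf : Y.IsFree) :
    ∃ f' : X.core.V → Y.core.V, X.core.IsCollapse Y.core f' ∧
      (Function.Injective f → Function.Injective f') := by
  have hcX := betweenClosed_minimalSubtree hX hXf
  have hsub : ∀ x : X.core.V, f x.1 ∈ Y.minimalSubtree := fun x =>
    minimalSubtree_subset (h.isInvariantSubtree_preimage hX hY
      (isInvariantSubtree_minimalSubtree hY hYf)) x.2
  have hsurj : ∀ y : Y.core.V, ∃ x : X.core.V, f x.1 = y.1 := fun y => by
    obtain ⟨x, hx, hxy⟩ := minimalSubtree_subset (h.isInvariantSubtree_image hX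
      (isInvariantSubtree_minimalSubtree hX hXf)) y.2
    exact ⟨⟨x, hx⟩, hxy⟩
  refine ⟨fun x => ⟨f x.1, hsub x⟩, ⟨fun g v => Subtype.ext (h.map_smul g v.1), fun y => ?_,
    fun u v huv => ?_, fun a b => ⟨fun hab => ⟨hab.ne, ?_⟩, ?_⟩⟩,
    fun hinj x y hxy => Subtype.ext (hinj (congrArg Subtype.val hxy))⟩
  · obtain ⟨x, hx⟩ := hsurj y
    exact ⟨x, Subtype.ext hx⟩
  · obtain ⟨p, hp⟩ := hX.exists_induce_walk hcX u v
    exact ⟨p, fun w hw => Subtype.ext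
      (h.map_eq_of_between (congrArg Subtype.val huv) (hp w hw))⟩
  · obtain ⟨u, hu⟩ := hsurj a
    obtain ⟨v, hv⟩ := hsurj b
    obtain ⟨p, hp⟩ := hX.exists_induce_walk hcX u v
    -- The vertices of the walk map between `a` and `b`, which are adjacent, hence to `a` or `b`.
    -- The edge that leaves the fibre of `a` thus ends in the fibre of `b`.
    obtain ⟨d, hd, hd1, hd2⟩ := p.exists_boundary_dart {x | f x.1 = a.1} hu
      (fun h' => hab.ne (Subtype.ext ((show f v.1 = a.1 from h').symm.trans hv)))
    refine ⟨d.fst, d.snd, Subtype.ext hd1, Subtype.ext ?_, d.adj⟩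
    have := h.map_between (hp d.snd (p.dart_snd_mem_support_of_mem_darts hd))
    rw [hu, hv] at this
    exact (this.eq_or_eq hab).resolve_left hd2
  · rintro ⟨hne, u, v, rfl, rfl, huv⟩
    exact (h.adj_iff _ _).mpr ⟨fun h => hne (Subtype.ext h), u.1, v.1, rfl, rfl, huv⟩

/-- By minimality each direction at `a` contains a translate of `a`, and by freeness of `Y` its
image differs from `f a`. Three such images are pairwise separated by `f a`. -/
theorem IsCollapse.isBranch (h : X.IsCollapse Y f) (hX : X.IsMinimalFreeTree)
    (hY : Y.IsMinimalFreeTree) {a : X.V} (ha : X.graph.IsBranch a) : Y.graph.IsBranch (f a) := by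
  have hc := hX.isTree.connected
  have key : ∀ d, X.graph.Adj a d → ∃ x, X.graph.Between a d x ∧ f x ≠ f a := fun d hd => by
    obtain ⟨g, hg⟩ := hX.isMinimal.exists_between_smul hX.isTree a d
    refine ⟨g • a, hg, fun he => ?_⟩
    rw [h.map_smul] at he
    rw [hY.isFree g _ he, one_smul] at hg
    exact hd.ne hg.eq.symm
  obtain ⟨d1, d2, d3, h1, h2, h3, h12, h23, h31⟩ := ha
  obtain ⟨x1, hx1, hf1⟩ := key d1 h1
  obtain ⟨x2, hx2, hf2⟩ := key d2 h2
  obtain ⟨x3, hx3, hf3⟩ := key d3 h3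
  exact hY.isTree.isBranch_of_between hf1 hf2 hf3
    (h.map_between (hc.between_of_directions_ne hX.isTree h1 h2 h12 hx1 hx2))
    (h.map_between (hc.between_of_directions_ne hX.isTree h2 h3 h23 hx2 hx3))
    (h.map_between (hc.between_of_directions_ne hX.isTree h3 h1 h31 hx3 hx1))

/-- The preimage is the median of lifts of three neighbours of `b`: its image lies between any two
of these neighbours, and only `b` does. -/
theorem IsCollapse.exists_isBranch (h : X.IsCollapse Y f) (hX : X.graph.IsTree) {b : Y.V}
    (hb : Y.graph.IsBranch b) : ∃ a, X.graph.IsBranch a ∧ f a = b := by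
  obtain ⟨e1, e2, e3, h1, h2, h3, h12, h23, h31⟩ := hb
  obtain ⟨x1, hx1⟩ := h.surjective e1
  obtain ⟨x2, hx2⟩ := h.surjective e2
  obtain ⟨x3, hx3⟩ := h.surjective e3
  obtain ⟨m, hm12, hm23, hm31⟩ := hX.exists_median x1 x2 x3
  have key : ∀ {x y c d}, Y.graph.Adj b c → Y.graph.Adj b d → f x = c → f y = d →
      X.graph.Between x m y → f m = c ∨ f m = b ∨ f m = d := by
    rintro x y c d hc hd rfl rfl hm
    rcases (h.map_between hm).split b with h' | h'
    · exact (h'.eq_or_eq hc.symm).imp id Or.inl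
    · exact Or.inr (h'.eq_or_eq hd)
  have hmb : f m = b := by
    have k1 := key h1 h2 hx1 hx2 hm12
    have k2 := key h2 h3 hx2 hx3 hm23
    have k3 := key h3 h1 hx3 hx1 hm31
    grind
  refine ⟨m, hX.isBranch_of_between ?_ ?_ ?_ hm12 hm23 hm31, hmb⟩
  · rintro rfl; exact h1.ne (hmb.symm.trans hx1)
  · rintro rfl; exact h2.ne (hmb.symm.trans hx2)
  · rintro rfl; exact h3.ne (hmb.symm.trans hx3)

theorem IsCollapse.exists_erase [Nontrivial G] [IsMulTorsionFree G] (h : X.IsCollapse Y f)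
    (hX : X.IsMinimalFreeTree) (hY : Y.IsMinimalFreeTree) :
    ∃ f' : X.erase.V → Y.erase.V, X.erase.IsCollapse Y.erase f' ∧
      (Function.Injective f → Function.Injective f') := by
  have hTX := hX.isTree
  have hTY := hY.isTree
  have hsub : ∀ x : X.erase.V, Y.valence (f x.1) ≠ 2 := fun x =>
    (hY.valence_ne_two_iff _).mpr (h.isBranch hX hY ((hX.valence_ne_two_iff _).mp x.2))
  have hsurj : ∀ y : Y.erase.V, ∃ x : X.erase.V, f x.1 = y.1 := fun y => by
    obtain ⟨x, hx, hxy⟩ := h.exists_isBranch hTX ((hY.valence_ne_two_iff _).mp y.2)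
    exact ⟨⟨x, (hX.valence_ne_two_iff _).mpr hx⟩, hxy⟩
  refine ⟨fun x => ⟨f x.1, hsub x⟩, ⟨fun g v => Subtype.ext (h.map_smul g v.1), fun y => ?_,
    fun u v huv => ?_, fun a b => ⟨fun hab => ⟨hab.ne, ?_⟩, ?_⟩⟩,
    fun hinj x y hxy => Subtype.ext (hinj (congrArg Subtype.val hxy))⟩
  · obtain ⟨x, hx⟩ := hsurj y
    exact ⟨x, Subtype.ext hx⟩
  · obtain ⟨p, hp⟩ := exists_erase_walk hTX u v
    exact ⟨p, fun w hw => Subtype.ext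
      (h.map_eq_of_between (congrArg Subtype.val huv) (hp w hw))⟩
  · obtain ⟨u, hu⟩ := hsurj a
    obtain ⟨v, hv⟩ := hsurj b
    obtain ⟨p, hp⟩ := exists_erase_walk hTX u v
    obtain ⟨d, hd, hd1, hd2⟩ := p.exists_boundary_dart {x | f x.1 = a.1} hu
      (fun h' => hab.ne (Subtype.ext ((show f v.1 = a.1 from h').symm.trans hv)))
    refine ⟨d.fst, d.snd, Subtype.ext hd1, ?_, d.adj⟩
    have := h.map_between (hp d.snd (p.dart_snd_mem_support_of_mem_darts hd))
    rw [hu, hv] at this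
    exact (((erase_adj_iff hTY a b).mp hab).2 ⟨f d.snd.1, hsub _⟩ this).resolve_left
      fun h' => hd2 (congrArg Subtype.val h')
  · rintro ⟨hne, u, v, rfl, rfl, huv⟩
    refine (erase_adj_iff hTY _ _).mpr ⟨hne, fun w hw => ?_⟩
    -- A remaining vertex `w` between the images lifts to a remaining vertex `c`, which lies beyond
    -- one end of the edge; so `w` is the image of that end.
    obtain ⟨c, hc⟩ := hsurj w
    rcases between_or_between_of_erase_adj hTX huv c with h' | h'
    · have h' := h.map_between h'
      rw [hc] at h'
      exact Or.inr (Subtype.ext (hTY.connected.between_antisymm hw h'))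
    · have h' := h.map_between h'
      rw [hc] at h'
      exact Or.inl (Subtype.ext (hTY.connected.between_antisymm hw.symm h'))

end Collapse

end GGraph

/-! ### Graphs with a potential are forests -/

open Classical in
/-- The indicator function of a pair. -/
noncomputable def pairIndicator {V : Type*} (u v : V) : Sym2 V → ZMod 2 :=
  fun e => if s(u, v) = e then 1 else 0

theorem pairIndicator_comm {V : Type*} (u v : V) : pairIndicator u v = pairIndicator v u := by
  unfold pairIndicator
  rw [Sym2.eq_swap]

theorem pairIndicator_self {V : Type*} (u v : V) : pairIndicator u v s(u, v) = 1 := if_pos rfl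

theorem pairIndicator_of_ne {V : Type*} {u v : V} {e : Sym2 V} (he : s(u, v) ≠ e) :
    pairIndicator u v e = 0 := if_neg he

namespace SimpleGraph

/-- Crossing an edge changes the potential in the coordinate of that edge only. A walk joining the
ends of an edge must therefore use the edge, which is thus a bridge. -/
theorem isAcyclic_of_potential {V : Type*} {T : SimpleGraph V} (δ : V → Sym2 V → ZMod 2)
    
    (hδ : ∀ u v, T.Adj u v → δ u + δ v = pairIndicator u v) : T.IsAcyclic := by
  refine isAcyclic_iff_forall_adj_isBridge.mpr fun u v huv => ?_
  refine isBridge_iff_forall_walk_mem_edges.mpr fun p => ?_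
  by_contra hp
  have key : ∀ {a b : V} (q : T.Walk a b), s(u, v) ∉ q.edges → δ a s(u, v) = δ b s(u, v) := by
    intro a b q
    induction q with
    | nil => exact fun _ => rfl
    | @cons a b c hab q ih =>
      intro hq
      rw [Walk.edges_cons, List.mem_cons, not_or] at hq
      have h := congrFun (hδ a b hab) s(u, v)
      rw [pairIndicator_of_ne (Ne.symm hq.1)] at h
      rw [← ih hq.2]
      exact CharTwo.add_eq_zero.mp h
  have h := congrFun (hδ u v huv) s(u, v)
  rw [pairIndicator_self, Pi.add_apply, key p hp, CharTwo.add_self_eq_zero] at h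
  exact zero_ne_one h

end SimpleGraph

/-! ### The augmentation -/

namespace GGraph

/-! ### Functions modulo 2 on unordered pairs -/

section Translate

variable {G A : Type*} [Group G] [MulAction G A]

/-- The action on functions on unordered pairs. -/
def translate (g : G) (φ : Sym2 A → ZMod 2) : Sym2 A → ZMod 2 :=
  fun e => φ (e.map (g⁻¹ • ·))

theorem translate_add (g : G) (φ ψ : Sym2 A → ZMod 2) :
    translate g (φ + ψ) = translate g φ + translate g ψ := rfl

theorem translate_zero (g : G) : translate g (0 : Sym2 A → ZMod 2) = 0 := rfl

theorem translate_one (φ : Sym2 A → ZMod 2) : translate (1 : G) φ = φ := by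
  funext e
  simp [translate]

theorem translate_mul (g h : G) (φ : Sym2 A → ZMod 2) :
    translate (g * h) φ = translate g (translate h φ) := by
  funext e
  simp only [translate, Sym2.map_map, mul_inv_rev]
  congr 2
  funext x
  exact mul_smul _ _ _

theorem translate_pairIndicator (g : G) (u v : A) :
    translate g (pairIndicator u v) = pairIndicator (g • u) (g • v) := by
  funext e
  have : s(u, v) = e.map (g⁻¹ • ·) ↔ s(g • u, g • v) = e := by
    constructor
    · intro h
      have := congrArg (Sym2.map (g • ·)) h
      simpa [Sym2.map_map, Function.comp_def] using this
    · rintro rfl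
      simp
  by_cases h : s(g • u, g • v) = e
  · rw [translate, ← this.mpr h, ← h, pairIndicator_self, pairIndicator_self]
  · rw [translate, pairIndicator_of_ne h, pairIndicator_of_ne fun h' => h (this.mp h')]

theorem add_self_eq_zero_of_zmod_two {B : Type*} (φ : B → ZMod 2) : φ + φ = 0 :=
  funext fun _ => CharTwo.add_self_eq_zero _

theorem add_eq_zero_iff_eq_of_zmod_two {B : Type*} {φ ψ : B → ZMod 2} : φ + ψ = 0 ↔ φ = ψ :=
  ⟨fun h => funext fun b => CharTwo.add_eq_zero.mp (congrFun h b),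
    fun h => h ▸ add_self_eq_zero_of_zmod_two φ⟩

end Translate

/-! ### The augmented graph is a tree -/

section Augment

variable {m n : ℕ} (h : m ≤ n) (X : GGraph (FreeGroup (Fin m))) (p : X.V)

theorem freeIncl_injective : Function.Injective (freeIncl h) :=
  FreeGroup.map_injective (Fin.castLE_injective h)

variable {X} in
theorem Induced.mk_eq_mk_iff {g g' : FreeGroup (Fin n)} {x y : X.V} :
    Induced.mk h X g x = Induced.mk h X g' y ↔
      ∃ k : FreeGroup (Fin m), g = g' * freeIncl h k ∧ y = k • x :=
  Quotient.eq (r := inducedSetoid h X)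

variable {X} in
theorem Induced.mk_mul_freeIncl (g : FreeGroup (Fin n)) (k : FreeGroup (Fin m)) (x : X.V) :
    Induced.mk h X (g * freeIncl h k) x = Induced.mk h X g (k • x) :=
  (Induced.mk_eq_mk_iff h).mpr ⟨k, rfl, rfl⟩

variable {X} in
theorem Induced.exists_mk (z : Induced h X) : ∃ g x, z = Induced.mk h X g x := by
  obtain ⟨g, x⟩ := z
  exact ⟨g, x, rfl⟩

variable {X} in
theorem Induced.mk_injective (g : FreeGroup (Fin n)) :
    Function.Injective (Induced.mk h X g) := fun x y hxy => by
  obtain ⟨k, h1, h2⟩ := (Induced.mk_eq_mk_iff h).mp hxy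
  rw [left_eq_mul, map_eq_one_iff _ (freeIncl_injective h)] at h1
  rw [h2, h1, one_smul]

/-- The exponent sum of the letter `i`. -/
def exponentSum (i : Fin n) : FreeGroup (Fin n) →* Multiplicative ℤ :=
  FreeGroup.lift fun j => if j = i then Multiplicative.ofAdd 1 else 1

theorem exponentSum_of (i : Fin n) :
    exponentSum i (FreeGroup.of i) = Multiplicative.ofAdd (1 : ℤ) := by
  simp [exponentSum]

theorem exponentSum_freeIncl {i : Fin n} (hi : m ≤ i.val) (k : FreeGroup (Fin m)) :
    exponentSum i (freeIncl h k) = 1 := by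
  have : (exponentSum i).comp (freeIncl h) = 1 := by
    ext j
    have hj : Fin.castLE h j ≠ i := by
      rintro rfl
      exact absurd j.2 (not_lt.mpr hi)
    simp [exponentSum, freeIncl, hj]
  exact DFunLike.congr_fun this k

variable {X} in
-- Elements of `F_m` do not involve the new letters, so the exponent sum of a new letter is an
-- invariant of vertices. It tells apart the ends of the new edges.
theorem exponentSum_eq_of_mk_eq {i : Fin n} (hi : m ≤ i.val) {g g' : FreeGroup (Fin n)} {x y : X.V}
    (he : Induced.mk h X g x = Induced.mk h X g' y) : exponentSum i g = exponentSum i g' := by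
  obtain ⟨k, rfl, -⟩ := (Induced.mk_eq_mk_iff h).mp he
  rw [map_mul, exponentSum_freeIncl h hi, mul_one]

theorem augment_adj_mk {x y : X.V} (g : FreeGroup (Fin n)) (hxy : X.graph.Adj x y) :
    (augment h X p).graph.Adj (Induced.mk h X g x) (Induced.mk h X g y) :=
  ⟨(Induced.mk_injective h g).ne hxy.ne, Or.inl (Or.inl ⟨g, x, y, hxy, rfl, rfl⟩)⟩

theorem augment_adj_mk_mul_of (g : FreeGroup (Fin n)) {i : Fin n} (hi : m ≤ i.val) :
    (augment h X p).graph.Adj (Induced.mk h X g p) (Induced.mk h X (g * FreeGroup.of i) p) := by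
  refine ⟨fun he => ?_, Or.inl (Or.inr ⟨g, i, hi, rfl, rfl⟩)⟩
  have := exponentSum_eq_of_mk_eq h hi he
  rw [map_mul, exponentSum_of, left_eq_mul] at this
  exact one_ne_zero (Multiplicative.ofAdd.injective this)

/-- The inclusion of a translate of `X`. -/
def augmentHom (g : FreeGroup (Fin n)) : X.graph →g (augment h X p).graph where
  toFun x := Induced.mk h X g x
  map_rel' hxy := augment_adj_mk h X p g hxy

variable {X p} in
theorem augment_adj_cases {P : Induced h X → Induced h X → Prop} (hsymm : ∀ a b, P a b → P b a)
    (h1 : ∀ g x y, X.graph.Adj x y → P (Induced.mk h X g x) (Induced.mk h X g y))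
    (h2 : ∀ (g : FreeGroup (Fin n)) (i : Fin n), m ≤ i.val →
      P (Induced.mk h X g p) (Induced.mk h X (g * FreeGroup.of i) p))
    {a b : Induced h X} (hab : (augment h X p).graph.Adj a b) : P a b := by
  obtain ⟨-, (⟨g, x, y, hxy, rfl, rfl⟩ | ⟨g, i, hi, rfl, rfl⟩) |
    (⟨g, x, y, hxy, rfl, rfl⟩ | ⟨g, i, hi, rfl, rfl⟩)⟩ := hab
  · exact h1 g x y hxy
  · exact h2 g i hi
  · exact hsymm _ _ (h1 g x y hxy)
  · exact hsymm _ _ (h2 g i hi)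

theorem augment_connected (hX : X.graph.Connected) : (augment h X p).graph.Connected := by
  have h1 : ∀ g x y, (augment h X p).graph.Reachable (Induced.mk h X g x) (Induced.mk h X g y) :=
    fun g x y => (hX.preconnected x y).map (augmentHom h X p g)
  have h2 : ∀ k g : FreeGroup (Fin n),
      (augment h X p).graph.Reachable (Induced.mk h X g p) (Induced.mk h X (g * k) p) := by
    intro k
    have hof : ∀ (i : Fin n) (g : FreeGroup (Fin n)), (augment h X p).graph.Reachable
        (Induced.mk h X g p) (Induced.mk h X (g * FreeGroup.of i) p) := by
      intro i g
      by_cases hi : m ≤ i.val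
      · exact (augment_adj_mk_mul_of h X p g hi).reachable
      -- For an old letter both vertices lie in the same copy of `X`.
      · have : FreeGroup.of i = freeIncl h (FreeGroup.of ⟨i, by omega⟩) := by simp [freeIncl]
        rw [this, Induced.mk_mul_freeIncl]
        exact h1 _ _ _
    induction k using FreeGroup.induction_on with
    | C1 => intro g; rw [mul_one]; exact SimpleGraph.Reachable.refl _
    | of i => exact hof i
    | inv_of i _ => intro g; simpa using (hof i (g * (FreeGroup.of i)⁻¹)).symm
    | mul k l ihk ihl => intro g; rw [← mul_assoc]; exact (ihk g).trans (ihl _)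
  refine (SimpleGraph.connected_iff _).mpr ⟨fun a b => ?_, ⟨Induced.mk h X 1 p⟩⟩
  obtain ⟨g, x, rfl⟩ := Induced.exists_mk h a
  obtain ⟨g', y, rfl⟩ := Induced.exists_mk h b
  have := h2 (g⁻¹ * g') g
  rw [mul_inv_cancel_left] at this
  exact (h1 g x p).trans (this.trans (h1 g' p y))

open Classical in
/-- The indicator function of the set of the edges between `p` and `x`. -/
noncomputable def potential (x : X.V) : Sym2 (Induced h X) → ZMod 2 := fun e =>
  if ∃ u v, X.graph.Adj u v ∧ X.graph.Between p u v ∧ X.graph.Between p v x ∧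
    e = s(Induced.mk h X 1 u, Induced.mk h X 1 v) then 1 else 0

theorem potential_base : potential h X p p = 0 := by
  funext e
  refine if_neg ?_
  rintro ⟨u, v, huv, h1, h2, -⟩
  obtain rfl := h2.eq
  exact huv.ne h1.eq

variable {X}

theorem potential_adj (hX : X.graph.IsTree) {x y : X.V} (hxy : X.graph.Adj x y) :
    potential h X p x + potential h X p y =
      pairIndicator (Induced.mk h X 1 x) (Induced.mk h X 1 y) := by
  have key : ∀ {x y : X.V}, X.graph.Adj x y → X.graph.Between p x y →
      potential h X p x + potential h X p y =
        pairIndicator (Induced.mk h X 1 x) (Induced.mk h X 1 y) := by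
    intro x y hxy hp
    classical
    have hc := hX.connected
    have hnot : ¬ X.graph.Between p y x := fun h' => hxy.ne (hc.between_antisymm hp h')
    funext e
    rw [Pi.add_apply]; simp only [potential]
    by_cases he : s(Induced.mk h X 1 x, Induced.mk h X 1 y) = e
    · subst he
      rw [pairIndicator_self, if_neg, if_pos, zero_add]
      · exact ⟨x, y, hxy, hp, SimpleGraph.Between.right _ _ _, rfl⟩
      · rintro ⟨u, v, huv, h1, h2, he⟩
        rcases Sym2.eq_iff.mp he with ⟨h3, h4⟩ | ⟨h3, h4⟩
        · rw [← Induced.mk_injective h 1 h4] at h2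
          exact hnot h2
        · rw [← Induced.mk_injective h 1 h3, ← Induced.mk_injective h 1 h4] at h1
          exact hnot h1
    · rw [pairIndicator_of_ne he, CharTwo.add_eq_zero]
      refine if_congr ⟨?_, ?_⟩ rfl rfl
      · rintro ⟨u, v, huv, h1, h2, h3⟩
        exact ⟨u, v, huv, h1, hp.trans_left h2, h3⟩
      · rintro ⟨u, v, huv, h1, h2, h3⟩
        refine ⟨u, v, huv, h1, ?_, h3⟩
        rcases h2.split x with h2 | h2
        · exact h2
        rcases h2.eq_or_eq hxy with rfl | rfl
        · exact SimpleGraph.Between.right _ _ _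
        -- Here `v` is `y`, and `u` and `x` are both the neighbour of `y` towards `p`; so `e` would
        -- be the excluded edge.
        · refine absurd ?_ he
          rw [h3, hc.adj_between_unique hxy.symm huv.symm hp.symm h1.symm]
  rcases hX.between_or_between_of_adj hxy p with h' | h'
  · rw [add_comm, key hxy.symm h'.symm, pairIndicator_comm]
  · exact key hxy h'.symm

/-- Modulo 2, the path from `p` to `k • x` is the path from `p` to `k • p` plus the translated path
from `p` to `x`: both sides change equally along edges and agree at `x = p`. -/
theorem potential_smul (hX : X.graph.IsTree) (k : FreeGroup (Fin m)) (x : X.V) :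
    potential h X p (k • x) =
      potential h X p (k • p) + translate (freeIncl h k) (potential h X p x) := by
  have hstep : ∀ {x y : X.V}, X.graph.Adj x y →
      potential h X p (k • x) + translate (freeIncl h k) (potential h X p x) =
      potential h X p (k • y) + translate (freeIncl h k) (potential h X p y) := by
    intro x y hxy
    have h1 := potential_adj h p hX (X.smul_adj k x y hxy)
    have h2 := congrArg (translate (freeIncl h k)) (potential_adj h p hX hxy)
    rw [translate_add, translate_pairIndicator, Induced.smul_mk, Induced.smul_mk, mul_one,
      ← one_mul (freeIncl h k), Induced.mk_mul_freeIncl, Induced.mk_mul_freeIncl, ← h1,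
      one_mul] at h2
    rw [← add_eq_zero_iff_eq_of_zmod_two]
    rw [← add_eq_zero_iff_eq_of_zmod_two] at h2
    rw [← h2]
    abel
  have hwalk : ∀ {x y : X.V}, X.graph.Walk x y →
      potential h X p (k • x) + translate (freeIncl h k) (potential h X p x) =
      potential h X p (k • y) + translate (freeIncl h k) (potential h X p y) := by
    intro x y q
    induction q with
    | nil => rfl
    | cons hab q ih => exact (hstep hab).trans ih
  obtain ⟨q⟩ := hX.connected.preconnected x p
  have := hwalk q
  rw [potential_base, translate_zero, add_zero] at this
  rw [← this, add_assoc, add_self_eq_zero_of_zmod_two, add_zero]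

/-- The affine action of a generator on the potentials. -/
noncomputable def stepPerm (i : Fin n) : Equiv.Perm (Sym2 (Induced h X) → ZMod 2) :=
  -- The constant is the edge set of the prospective path from the basepoint to its translate by the
  -- generator: a path in `X` for an old letter, a single new edge for a new one.
  let c : Sym2 (Induced h X) → ZMod 2 :=
    if hi : i.val < m then potential h X p ((FreeGroup.of ⟨i, hi⟩ : FreeGroup (Fin m)) • p)
    else pairIndicator (Induced.mk h X 1 p) (Induced.mk h X (FreeGroup.of i) p)
  { toFun φ := c + translate (FreeGroup.of i) φ
    invFun φ := translate (FreeGroup.of i)⁻¹ (c + φ)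
    left_inv φ := by
      change translate _ (c + (c + translate _ φ)) = φ
      rw [← add_assoc, add_self_eq_zero_of_zmod_two, zero_add, ← translate_mul, inv_mul_cancel,
        translate_one]
    right_inv φ := by
      change c + translate _ (translate _ (c + φ)) = φ
      rw [← translate_mul, mul_inv_cancel, translate_one, ← add_assoc,
        add_self_eq_zero_of_zmod_two, zero_add] }

/-- The affine action on the potentials. -/
noncomputable def affineAction :
    FreeGroup (Fin n) →* Equiv.Perm (Sym2 (Induced h X) → ZMod 2) :=
  FreeGroup.lift (stepPerm h p)

theorem affineAction_of (i : Fin n) : affineAction h p (FreeGroup.of i) = stepPerm h p i :=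
  FreeGroup.lift_apply_of

theorem affineAction_add (g : FreeGroup (Fin n)) (φ ψ : Sym2 (Induced h X) → ZMod 2) :
    affineAction h p g φ + affineAction h p g ψ = translate g (φ + ψ) := by
  induction g using FreeGroup.induction_on generalizing φ ψ with
  | C1 => rw [map_one, translate_one]; rfl
  | of i =>
    rw [affineAction_of, translate_add]
    simp only [stepPerm, Equiv.coe_fn_mk]
    rw [add_add_add_comm, add_self_eq_zero_of_zmod_two, zero_add]
  | inv_of i ih =>
    have := ih ((affineAction h p (FreeGroup.of i)⁻¹) φ) ((affineAction h p (FreeGroup.of i)⁻¹) ψ)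
    rw [← Equiv.Perm.mul_apply, ← Equiv.Perm.mul_apply, ← map_mul, mul_inv_cancel, map_one] at this
    change φ + ψ = _ at this
    rw [this, ← translate_mul, inv_mul_cancel, translate_one]
  | mul g g' ih ih' =>
    rw [map_mul, Equiv.Perm.mul_apply, Equiv.Perm.mul_apply, ih, ih', translate_mul]

/-- For generators this is `potential_smul`. It is what makes the potential well defined on `F_n
×_{F_m} X`. -/
theorem affineAction_freeIncl (hX : X.graph.IsTree) (k : FreeGroup (Fin m)) (x : X.V) :
    affineAction h p (freeIncl h k) (potential h X p x) = potential h X p (k • x) := by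
  induction k using FreeGroup.induction_on generalizing x with
  | C1 => simp
  | of i =>
    have : freeIncl h (FreeGroup.of i) = FreeGroup.of (Fin.castLE h i) := by simp [freeIncl]
    rw [potential_smul h p hX, this, affineAction_of]
    simp [stepPerm]
  | inv_of i ih =>
    have := ih ((FreeGroup.of i)⁻¹ • x)
    rw [smul_inv_smul] at this
    rw [← this, ← Equiv.Perm.mul_apply, ← map_mul, ← map_mul, inv_mul_cancel, map_one, map_one]
    rfl
  | mul k l ihk ihl => rw [map_mul, map_mul, Equiv.Perm.mul_apply, ihl, ihk, mul_smul]

/-- The potential of the class of `(g, x)` is obtained by letting `g` act affinely on the potential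
of `x`. By equivariance the edge condition need only be checked on `X` and on the new edges at the
basepoint. -/
theorem augment_isTree (hX : X.graph.IsTree) : (augment h X p).graph.IsTree := by
  refine ⟨augment_connected h X p hX.connected, ?_⟩
  let δ : Induced h X → Sym2 (Induced h X) → ZMod 2 :=
    Quotient.lift (fun a => affineAction h p a.1 (potential h X p a.2)) (by
      rintro ⟨g, x⟩ ⟨g', y⟩ ⟨k, h1, h2⟩
      dsimp only at h1 h2 ⊢
      rw [h1, h2, map_mul, Equiv.Perm.mul_apply, affineAction_freeIncl h p hX])
  have hδ : ∀ g x, δ (Induced.mk h X g x) = affineAction h p g (potential h X p x) :=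
    fun _ _ => rfl
  have key : ∀ {a b : Induced h X}, (augment h X p).graph.Adj a b →
      δ a + δ b = pairIndicator a b := by
    intro a b hab
    refine augment_adj_cases h (P := fun a b => δ a + δ b = pairIndicator a b) ?_ ?_ ?_ hab
    · intro a b h'
      rw [add_comm, h', pairIndicator_comm]
    · intro g x y hxy
      rw [hδ, hδ, affineAction_add, potential_adj h p hX hxy, translate_pairIndicator,
        Induced.smul_mk, Induced.smul_mk, mul_one]
    · intro g i hi
      rw [hδ, hδ, map_mul, Equiv.Perm.mul_apply, affineAction_add, affineAction_of, potential_base,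
        zero_add]
      have : stepPerm h p i 0 =
          pairIndicator (Induced.mk h X 1 p) (Induced.mk h X (FreeGroup.of i) p) := by
        simp [stepPerm, not_lt.mpr hi, translate_zero]
      rw [this, translate_pairIndicator, Induced.smul_mk, Induced.smul_mk, mul_one]
  exact SimpleGraph.isAcyclic_of_potential δ fun u v huv => key huv

end Augment

end GGraph

namespace GGraph

/-! ### Minimality, valences and functoriality of the augmentation -/

section Augment

variable {m n : ℕ} (h : m ≤ n) {X : GGraph (FreeGroup (Fin m))} (p : X.V)

theorem augment_isFree (hf : X.IsFree) : (augment h X p).IsFree := by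
  intro g z hz
  obtain ⟨g', x, rfl⟩ := Induced.exists_mk h z
  obtain ⟨k, h1, h2⟩ := (Induced.mk_eq_mk_iff h).mp
    (show Induced.mk h X (g * g') x = Induced.mk h X g' x from hz)
  rw [hf k x h2.symm, map_one, mul_one] at h1
  exact mul_eq_right.mp h1

theorem Induced.mk_one_smul (k : FreeGroup (Fin m)) (x : X.V) :
    Induced.mk h X 1 (k • x) = freeIncl h k • Induced.mk h X 1 x := by
  rw [Induced.smul_mk, mul_one, ← Induced.mk_mul_freeIncl, one_mul]

theorem augment_between_iff (hX : X.graph.IsTree) (x w y : X.V) :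
    (augment h X p).graph.Between (Induced.mk h X 1 x) (Induced.mk h X 1 w) (Induced.mk h X 1 y) ↔
      X.graph.Between x w y := by
  refine ⟨fun hb q => ?_, fun hb => ?_⟩
  · obtain ⟨v, hv, hvw⟩ := hb.exists_of_hom (augmentHom h X p 1) q
    rwa [← Induced.mk_injective h 1 hvw]
  · obtain ⟨q, hq, hw⟩ := hX.exists_walk_between x y
    have hq' : (q.map (augmentHom h X p 1)).IsPath := hq.map (Induced.mk_injective h 1)
    refine ((augment_isTree h p hX).between_iff hq').mpr ?_
    exact SimpleGraph.Walk.support_map (augmentHom h X p 1) q ▸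
      List.mem_map_of_mem (f := augmentHom h X p 1) ((hw w).mpr hb)

theorem betweenClosed_range_mk (hX : X.graph.IsTree) :
    (augment h X p).graph.BetweenClosed (Set.range (Induced.mk h X 1)) := by
  rintro _ ⟨x, rfl⟩ _ ⟨y, rfl⟩ w hw
  obtain ⟨q⟩ := hX.connected.preconnected x y
  obtain ⟨v, -, hv⟩ := SimpleGraph.Between.exists_of_hom (augmentHom h X p 1) hw q
  exact ⟨v, hv⟩

/-- A subtree that is invariant under the smaller group and that meets `X` contains `X`. -/
theorem range_mk_subset (hX : X.graph.IsTree) (hm : X.IsMinimal) {S : Set (Induced h X)}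
    (hS : ∀ (k : FreeGroup (Fin m)), ∀ v ∈ S, freeIncl h k • v ∈ S)
    (hc : (augment h X p).graph.BetweenClosed S) {x : X.V} (hx : Induced.mk h X 1 x ∈ S) :
    Set.range (Induced.mk h X 1) ⊆ S := by
  have : X.IsInvariantSubtree (Induced.mk h X 1 ⁻¹' S) := by
    refine (isInvariantSubtree_iff hX).mpr ⟨fun k v hv => ?_, fun a ha b hb w hw => ?_, x, hx⟩
    · rw [Set.mem_preimage, Induced.mk_one_smul]
      exact hS k _ hv
    · exact hc _ ha _ hb _ ((augment_between_iff h p hX a w b).mpr hw)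
  rintro _ ⟨y, rfl⟩
  have hy : y ∈ Induced.mk h X 1 ⁻¹' S := by
    rw [hm _ this]
    exact Set.mem_univ y
  exact hy

theorem augment_isMinimal (hX : X.graph.IsTree) (hm : X.IsMinimal) :
    (augment h X p).IsMinimal := by
  intro S hS
  obtain ⟨h1, h2, ⟨z, hz⟩⟩ := (isInvariantSubtree_iff (augment_isTree h p hX)).mp hS
  have hmk : ∀ (g g' : FreeGroup (Fin n)) x, Induced.mk h X g x ∈ S →
      Induced.mk h X (g' * g) x ∈ S := fun g g' x hx => h1 g' _ hx
  obtain ⟨g, x, rfl⟩ := Induced.exists_mk h z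
  have hx : Induced.mk h X 1 x ∈ S := by simpa using hmk g g⁻¹ x hz
  have hsub := range_mk_subset h p hX hm (fun k v hv => h1 (freeIncl h k) v hv) h2 hx
  refine Set.eq_univ_of_forall fun z => ?_
  obtain ⟨g, y, rfl⟩ := Induced.exists_mk h z
  have := hmk 1 g y (hsub ⟨y, rfl⟩)
  rwa [mul_one] at this

theorem augment_isMinimalFreeTree (hX : X.IsMinimalFreeTree) :
    (augment h X p).IsMinimalFreeTree :=
  ⟨augment_isTree h p hX.isTree, augment_isFree h p hX.isFree,
    augment_isMinimal h p hX.isTree hX.isMinimal⟩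

theorem augment_valence_mk_one {x : X.V} (hx : ∀ k : FreeGroup (Fin m), x ≠ k • p) :
    (augment h X p).valence (Induced.mk h X 1 x) = X.valence x := by
  have : (augment h X p).graph.neighborSet (Induced.mk h X 1 x) =
      Induced.mk h X 1 '' X.graph.neighborSet x := by
    ext b
    constructor
    · have hnot : ∀ g : FreeGroup (Fin n), Induced.mk h X 1 x ≠ Induced.mk h X g p := by
        intro g hg
        obtain ⟨k, -, hk⟩ := (Induced.mk_eq_mk_iff h).mp hg
        exact hx k⁻¹ (by rw [hk, inv_smul_smul])
      have key : ∀ (g : FreeGroup (Fin n)) (u v : X.V), X.graph.Adj u v →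
          Induced.mk h X 1 x = Induced.mk h X g u →
            Induced.mk h X g v ∈ Induced.mk h X 1 '' X.graph.neighborSet x := by
        intro g u v huv hg
        obtain ⟨k, rfl, rfl⟩ := (Induced.mk_eq_mk_iff h).mp hg.symm
        refine ⟨k • v, X.smul_adj k u v huv, ?_⟩
        rw [Induced.mk_mul_freeIncl]
      rintro ⟨-, (⟨g, u, v, huv, h1, rfl⟩ | ⟨g, i, -, h1, -⟩) |
        (⟨g, u, v, huv, rfl, h1⟩ | ⟨g, i, -, -, h1⟩)⟩
      · exact key g u v huv h1
      · exact absurd h1 (hnot _)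
      · exact key g v u huv.symm h1
      · exact absurd h1 (hnot _)
    · rintro ⟨y, hy, rfl⟩
      exact augment_adj_mk h X p 1 hy
  exact (congrArg Set.encard this).trans ((Induced.mk_injective h 1).encard_image _)

theorem augment_valence_ne_two
    (hv : ∀ v : X.V, (∀ g : FreeGroup (Fin m), v ≠ g • p) → X.valence v ≠ 2) (v : Induced h X)
    (hvp : ∀ g : FreeGroup (Fin n), v ≠ g • Induced.mk h X 1 p) :
    (augment h X p).valence v ≠ 2 := by
  obtain ⟨g, x, rfl⟩ := Induced.exists_mk h v
  have hx : ∀ k : FreeGroup (Fin m), x ≠ k • p := by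
    rintro k rfl
    refine hvp (g * freeIncl h k) ?_
    rw [Induced.smul_mk, mul_one, Induced.mk_mul_freeIncl]
  have h1 := (augment h X p).valence_smul g (Induced.mk h X 1 x)
  have h2 : g • Induced.mk h X 1 x = Induced.mk h X g x := by rw [Induced.smul_mk, mul_one]
  have h3 : (augment h X p).valence (Induced.mk h X g x) = X.valence x := by
    rw [← h2, ← augment_valence_mk_one h p hx]
    exact h1
  rw [h3]
  exact hv x hx

/-- Three neighbours are one in `X` and the two along the lifts of the first new circle; the
exponent sum of its letter is 0, 1 and -1 on them. -/
theorem augment_isBranch_base (hmn : m < n) (hX : X.IsMinimalFreeTree) (hm : 2 ≤ m) :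
    (augment hmn.le X p).graph.IsBranch (Induced.mk hmn.le X 1 p) := by
  have := nontrivial_freeGroup_fin hm
  obtain ⟨k, hk⟩ := exists_ne (1 : FreeGroup (Fin m))
  obtain ⟨q, hq, -⟩ := hX.isTree.exists_adj_between (u := p) (v := k • p)
    fun h' => hk (hX.isFree k p h'.symm)
  let i : Fin n := ⟨m, hmn⟩
  have hi : m ≤ i.val := le_rfl
  have h1 := augment_adj_mk_mul_of hmn.le X p 1 hi
  have h2 := (augment_adj_mk_mul_of hmn.le X p (FreeGroup.of i)⁻¹ hi).symm
  rw [one_mul] at h1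
  rw [inv_mul_cancel] at h2
  have hne : ∀ {g g' : FreeGroup (Fin n)} {x y : X.V}, exponentSum i g ≠ exponentSum i g' →
      Induced.mk hmn.le X g x ≠ Induced.mk hmn.le X g' y :=
    fun hg he => hg (exponentSum_eq_of_mk_eq hmn.le hi he)
  refine ⟨_, _, _, augment_adj_mk hmn.le X p 1 hq, h1, h2, hne ?_, hne ?_, hne ?_⟩ <;>
  · simp only [map_one, map_inv, exponentSum_of, ← ofAdd_neg, ← ofAdd_zero, ne_eq,
      EmbeddingLike.apply_eq_iff_eq]
    decide

theorem augment_valence_ne_two_of_lt (hmn : m < n) (hm : 2 ≤ m) (hX : X.IsMinimalFreeTree)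
    (hv : ∀ v : X.V, (∀ g : FreeGroup (Fin m), v ≠ g • p) → X.valence v ≠ 2)
    (v : (augment hmn.le X p).V) : (augment hmn.le X p).valence v ≠ 2 := by
  by_cases hvp : ∀ g : FreeGroup (Fin n), v ≠ g • Induced.mk hmn.le X 1 p
  · exact augment_valence_ne_two hmn.le p hv v hvp
  · push Not at hvp
    obtain ⟨g, rfl⟩ := hvp
    have := (augment hmn.le X p).valence_smul g (Induced.mk hmn.le X 1 p)
    intro h2
    exact valence_ne_two_of_isBranch (augment_isBranch_base p hmn hX hm) (this.symm.trans h2)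

/-- The map induced by `f` on each copy works: up to the identification by `F_m`, two points of one
fibre lie in the same copy of `X`, and new edges go to new edges because basepoints correspond. -/
theorem IsCollapse.exists_augment {Y : GGraph (FreeGroup (Fin m))} {f : X.V → Y.V}
    (hf : X.IsCollapse Y f) {q : Y.V} (hpq : f p = q) :
    ∃ f' : (augment h X p).V → (augment h Y q).V, (augment h X p).IsCollapse (augment h Y q) f' ∧
      (∀ g x, f' (Induced.mk h X g x) = Induced.mk h Y g (f x)) ∧
      (Function.Injective f → Function.Injective f') := by
  subst hpq
  let f' : Induced h X → Induced h Y := Quotient.map (sa := inducedSetoid h X)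
    (sb := inducedSetoid h Y) (fun a => (a.1, f a.2)) (by
      rintro a b ⟨k, h1, h2⟩
      exact ⟨k, h1, by rw [h2, hf.map_smul]⟩)
  have hf' : ∀ g x, f' (Induced.mk h X g x) = Induced.mk h Y g (f x) := fun _ _ => rfl
  have hfib : ∀ g g' x y, f' (Induced.mk h X g x) = f' (Induced.mk h X g' y) →
      ∃ k : FreeGroup (Fin m), Induced.mk h X g x = Induced.mk h X g' (k • x) ∧
        f (k • x) = f y := by
    intro g g' x y he
    obtain ⟨k, rfl, h2⟩ := (Induced.mk_eq_mk_iff h).mp he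
    exact ⟨k, Induced.mk_mul_freeIncl h g' k x, by rw [h2, hf.map_smul]⟩
  refine ⟨f', ⟨?_, ?_, ?_, fun a b => ⟨fun hab => ⟨hab.ne, ?_⟩, ?_⟩⟩, hf', ?_⟩
  · rintro g z
    obtain ⟨g', x, rfl⟩ := Induced.exists_mk h z
    rfl
  · intro z
    obtain ⟨g, y, rfl⟩ := Induced.exists_mk h z
    obtain ⟨x, rfl⟩ := hf.surjective y
    exact ⟨Induced.mk h X g x, rfl⟩
  · intro a b hab
    obtain ⟨g, x, rfl⟩ := Induced.exists_mk h a
    obtain ⟨g', y, rfl⟩ := Induced.exists_mk h b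
    obtain ⟨k, h1, h2⟩ := hfib g g' x y hab
    rw [h1]
    obtain ⟨r, hr⟩ := hf.exists_walk _ _ h2
    refine ⟨r.map (augmentHom h X p g'), fun w hw => ?_⟩
    obtain ⟨v, hv, rfl⟩ : ∃ v ∈ r.support, augmentHom h X p g' v = w :=
      List.mem_map.mp (SimpleGraph.Walk.support_map (augmentHom h X p g') r ▸ hw)
    change Induced.mk h Y g' (f v) = Induced.mk h Y g' (f (k • x))
    rw [hr v hv]
  · refine augment_adj_cases h (P := fun a b => ∃ u v, f' u = a ∧ f' v = b ∧
      (augment h X p).graph.Adj u v) ?_ ?_ ?_ hab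
    · rintro a b ⟨u, v, hu, hv, huv⟩
      exact ⟨v, u, hv, hu, huv.symm⟩
    · intro g x y hxy
      obtain ⟨-, u, v, rfl, rfl, huv⟩ := (hf.adj_iff x y).mp hxy
      exact ⟨_, _, rfl, rfl, augment_adj_mk h X p g huv⟩
    · intro g i hi
      exact ⟨_, _, rfl, rfl, augment_adj_mk_mul_of h X p g hi⟩
  · rintro ⟨hne, u, v, rfl, rfl, huv⟩
    refine augment_adj_cases h (P := fun u v => f' u ≠ f' v →
      (augment h Y (f p)).graph.Adj (f' u) (f' v)) ?_ ?_ ?_ huv hne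
    · exact fun a b hab hne => (hab hne.symm).symm
    · intro g x y hxy hne
      refine augment_adj_mk h Y (f p) g ((hf.adj_or_eq hxy).resolve_left fun he => hne ?_)
      rw [hf', hf', he]
    · exact fun g i hi _ => augment_adj_mk_mul_of h Y (f p) g hi
  · intro hinj a b hab
    obtain ⟨g, x, rfl⟩ := Induced.exists_mk h a
    obtain ⟨g', y, rfl⟩ := Induced.exists_mk h b
    obtain ⟨k, h1, h2⟩ := hfib g g' x y hab
    rw [h1, hinj h2]

/-- The copy of `X` is an `F_m`-invariant subtree, so it contains the minimal one, which then meets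
`X` and contains it by minimality of `X`. -/
theorem minimalSubtree_comap_augment (hm : 2 ≤ m) (hX : X.IsMinimalFreeTree) :
    ((augment h X p).comap (freeIncl h)).minimalSubtree = Set.range (Induced.mk h X 1) := by
  have := nontrivial_freeGroup_fin hm
  have hT : ((augment h X p).comap (freeIncl h)).graph.IsTree := augment_isTree h p hX.isTree
  have hF := isFree_comap (freeIncl_injective h) (augment_isFree h p hX.isFree)
  have hsub : ((augment h X p).comap (freeIncl h)).minimalSubtree ⊆
      Set.range (Induced.mk h X 1) := by
    refine minimalSubtree_subset ((isInvariantSubtree_iff hT).mpr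
      ⟨?_, betweenClosed_range_mk h p hX.isTree, Set.range_nonempty_iff_nonempty.mpr ⟨p⟩⟩)
    rintro k _ ⟨x, rfl⟩
    exact ⟨k • x, Induced.mk_one_smul h k x⟩
  refine Set.Subset.antisymm hsub ?_
  obtain ⟨h1, h2, ⟨z, hz⟩⟩ := (isInvariantSubtree_iff hT).mp
    (isInvariantSubtree_minimalSubtree hT hF)
  obtain ⟨x, rfl⟩ := hsub hz
  exact range_mk_subset h p hX.isTree hX.isMinimal h1 h2 hz

theorem exists_isCollapse_core_comap_augment (hm : 2 ≤ m) (hX : X.IsMinimalFreeTree) :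
    ∃ f : X.V → ((augment h X p).comap (freeIncl h)).core.V,
      X.IsCollapse ((augment h X p).comap (freeIncl h)).core f ∧ Function.Injective f := by
  have hrange := minimalSubtree_comap_augment h p hm hX
  let f : X.V → ((augment h X p).comap (freeIncl h)).core.V :=
    fun x => ⟨Induced.mk h X 1 x, hrange ▸ ⟨x, rfl⟩⟩
  have hf : Function.Injective f := fun x y hxy =>
    Induced.mk_injective h 1 (congrArg Subtype.val hxy)
  have hsurj : Function.Surjective f := by
    rintro ⟨z, hz⟩
    obtain ⟨x, rfl⟩ := hrange.subset hz
    exact ⟨x, rfl⟩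
  refine ⟨f, ⟨fun k x => Subtype.ext (Induced.mk_one_smul h k x), hsurj, fun u v huv => ?_,
    fun a b => ⟨fun hab => ⟨hab.ne, ?_⟩, ?_⟩⟩, hf⟩
  · obtain rfl := hf huv
    exact ⟨.nil, by simp⟩
  · obtain ⟨x, rfl⟩ := hsurj a
    obtain ⟨y, rfl⟩ := hsurj b
    refine ⟨x, y, rfl, rfl, ?_⟩
    have hab : (augment h X p).graph.Adj (Induced.mk h X 1 x) (Induced.mk h X 1 y) := hab
    -- The first vertex on the way from `x` to `y` in `X` is also between them in the augmentation,
    -- where they are adjacent; so it is `y`.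
    obtain ⟨d, hd, hd'⟩ := hX.isTree.exists_adj_between (u := x) (v := y)
      fun he => hab.ne (he ▸ rfl)
    rcases ((augment_between_iff h p hX.isTree x d y).mpr hd').eq_or_eq hab with he | he
    · exact absurd (Induced.mk_injective h 1 he) hd.ne'
    · rwa [← Induced.mk_injective h 1 he]
  · rintro ⟨-, u, v, rfl, rfl, huv⟩
    exact augment_adj_mk h X p 1 huv

end Augment

/-! ### Trees in which nothing is erased -/

section EraseNothing

variable {G : Type} [Group G] {X : GGraph G}

theorem isCollapse_erase_of_valence_ne_two (hX : X.graph.IsTree)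
    (hv : ∀ v : X.V, X.valence v ≠ 2) :
    X.IsCollapse X.erase fun v => ⟨v, hv v⟩ := by
  refine ⟨fun _ _ => rfl, fun v => ⟨v.1, rfl⟩, fun u v huv => ?_, fun a b => ?_⟩
  · obtain rfl : u = v := congrArg Subtype.val huv
    exact ⟨.nil, fun w hw => by rw [List.mem_singleton.mp hw]⟩
  · rw [erase_adj_iff hX]
    refine and_congr_right fun hab => ⟨fun h => ⟨a.1, b.1, rfl, rfl, ?_⟩, ?_⟩
    · obtain ⟨d, hd, hd'⟩ := hX.exists_adj_between fun he => hab (Subtype.ext he)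
      rcases h ⟨d, hv d⟩ hd' with he | he
      · exact absurd (congrArg Subtype.val he) hd.ne'
      · rwa [← (congrArg Subtype.val he : d = b.1)]
    · rintro ⟨u, v, rfl, rfl, huv⟩ w hw
      exact (hw.eq_or_eq huv).imp Subtype.ext Subtype.ext

end EraseNothing

end GGraph

/-! ### The maps of the spines -/

/-- A map of vertices that preserves the relation that generates adjacency is simplicial. -/
def SimplicialMap.ofRel {α β : Type*} {r : α → α → Prop} {s : β → β → Prop} (f : α → β)
    (hf : ∀ x y, r x y → s (f x) (f y)) :
    SimplicialMap (flagComplex (SimpleGraph.fromRel r)) (flagComplex (SimpleGraph.fromRel s)) where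
  toFun := f
  map_face t ht := by
    classical
    refine ⟨t.image f, ⟨ht.1.image f, ?_⟩, Finset.coe_image⟩
    rw [Finset.coe_image]
    rintro _ ⟨x, hx, rfl⟩ _ ⟨y, hy, rfl⟩ hne
    have hxy := ht.2 hx hy fun he => hne (congrArg f he)
    exact ⟨hne, hxy.2.imp (hf x y) (hf y x)⟩

open GGraph

theorem OuterTree.isMinimalFreeTree {n : ℕ} (T : OuterTree n) : T.X.IsMinimalFreeTree :=
  ⟨T.isTree, T.isFree, T.isMinimal⟩

theorem AuterTree.isMinimalFreeTree {n : ℕ} (T : AuterTree n) : T.X.IsMinimalFreeTree :=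
  ⟨T.isTree, T.isFree, T.isMinimal⟩

theorem OuterTree.toVertex_eq {n : ℕ} {S T : OuterTree n} {f : S.X.V → T.X.V}
    (hf : S.X.IsCollapse T.X f) (hinj : Function.Injective f) : S.toVertex = T.toVertex := by
  obtain ⟨e, he, -⟩ := hf.exists_iso hinj
  exact Quotient.sound ⟨e, he⟩

theorem AuterTree.toVertex_eq {n : ℕ} {S T : AuterTree n} {f : S.X.V → T.X.V}
    (hf : S.X.IsCollapse T.X f) (hinj : Function.Injective f) (hb : f S.base = T.base) :
    S.toVertex = T.toVertex := by
  obtain ⟨e, he, rfl⟩ := hf.exists_iso hinj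
  exact Quotient.sound ⟨e, he, hb⟩

/-- The tree obtained by forgetting the basepoint. -/
def AuterTree.forget {n : ℕ} (hn : 2 ≤ n) (T : AuterTree n) : OuterTree n :=
  T.isMinimalFreeTree.toOuterTree hn

theorem AuterTree.exists_forget_isCollapse {n : ℕ} (hn : 2 ≤ n) {S T : AuterTree n}
    {f : S.X.V → T.X.V} (hf : S.X.IsCollapse T.X f) :
    ∃ f' : (S.forget hn).X.V → (T.forget hn).X.V, (S.forget hn).X.IsCollapse (T.forget hn).X f' ∧
      (Function.Injective f → Function.Injective f') := by
  have := nontrivial_freeGroup_fin hn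
  exact hf.exists_erase S.isMinimalFreeTree T.isMinimalFreeTree

/-- The forgetful map. -/
def forgetfulMap {n : ℕ} (hn : 2 ≤ n) : SimplicialMap (auterSpine n) (outerSpine n) :=
  SimplicialMap.ofRel
    (Quotient.lift (fun T : AuterTree n => (T.forget hn).toVertex) (by
      rintro S T ⟨e, he, -⟩
      obtain ⟨f', hf', hinj⟩ := AuterTree.exists_forget_isCollapse hn (isCollapse_of_iso e he)
      exact OuterTree.toVertex_eq hf' (hinj e.injective)))
    (by
      rintro _ _ ⟨S, T, rfl, rfl, f, hf, -⟩
      obtain ⟨f', hf', -⟩ := AuterTree.exists_forget_isCollapse hn hf.isCollapse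
      exact ⟨S.forget hn, T.forget hn, rfl, rfl, f', hf'.isForestCollapse (T.forget hn).isFree⟩)

theorem isForgetfulMap_forgetfulMap {n : ℕ} (hn : 2 ≤ n) : IsForgetfulMap (forgetfulMap hn) :=
  fun T => ⟨T.forget hn, rfl, rfl⟩

/-- The tree obtained by augmentation. -/
def AuterTree.augment {m n : ℕ} (h : m ≤ n) (T : AuterTree m) : AuterTree n where
  X := _root_.augment h T.X T.base
  base := Induced.mk h T.X 1 T.base
  isTree := augment_isTree h T.base T.isTree
  isFree := augment_isFree h T.base T.isFree
  isMinimal := augment_isMinimal h T.base T.isTree T.isMinimal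
  valence_ne := augment_valence_ne_two h T.base T.valence_ne

/-- The augmentation map. -/
def augmentationMap {m n : ℕ} (h : m ≤ n) : SimplicialMap (auterSpine m) (auterSpine n) :=
  SimplicialMap.ofRel
    (Quotient.lift (fun T : AuterTree m => (T.augment h).toVertex) (by
      rintro S T ⟨e, he, hb⟩
      obtain ⟨f', hf', hmk, hinj⟩ := (isCollapse_of_iso e he).exists_augment h S.base hb
      refine AuterTree.toVertex_eq (S := S.augment h) (T := T.augment h) hf' (hinj e.injective) ?_
      exact (hmk 1 S.base).trans (congrArg _ hb)))
    (by
      rintro _ _ ⟨S, T, rfl, rfl, f, hf, hb⟩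
      obtain ⟨f', hf', hmk, -⟩ := hf.isCollapse.exists_augment h S.base hb
      exact ⟨S.augment h, T.augment h, rfl, rfl, f', hf'.isForestCollapse (T.augment h).isFree,
        (hmk 1 S.base).trans (congrArg _ hb)⟩)

theorem isAugmentationMap_augmentationMap {m n : ℕ} (h : m ≤ n) :
    IsAugmentationMap h (augmentationMap h) :=
  fun T => ⟨augment_isTree h T.base T.isTree, augment_isFree h T.base T.isFree,
    augment_isMinimal h T.base T.isTree T.isMinimal,
    augment_valence_ne_two h T.base T.valence_ne, rfl⟩

theorem isMinimalFreeTree_core_comap {m n : ℕ} (hm : 2 ≤ m) (h : m ≤ n)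
    {X : GGraph (FreeGroup (Fin n))} (hX : X.IsMinimalFreeTree) :
    (X.comap (freeIncl h)).core.IsMinimalFreeTree :=
  have := nontrivial_freeGroup_fin hm
  isMinimalFreeTree_core (X := X.comap (freeIncl h)) hX.isTree
    (isFree_comap (freeIncl_injective h) hX.isFree)

/-- The tree obtained by restriction of the action. -/
def OuterTree.restrict {m n : ℕ} (hm : 2 ≤ m) (h : m ≤ n) (T : OuterTree n) : OuterTree m :=
  (isMinimalFreeTree_core_comap hm h T.isMinimalFreeTree).toOuterTree hm

theorem exists_restrictTree_isCollapse {m n : ℕ} (hm : 2 ≤ m) (h : m ≤ n)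
    {X Y : GGraph (FreeGroup (Fin n))} (hX : X.IsMinimalFreeTree) (hY : Y.IsMinimalFreeTree)
    {f : X.V → Y.V} (hf : X.IsCollapse Y f) :
    ∃ f' : (restrictTree h X).V → (restrictTree h Y).V,
      (restrictTree h X).IsCollapse (restrictTree h Y) f' ∧
      (Function.Injective f → Function.Injective f') := by
  have := nontrivial_freeGroup_fin hm
  obtain ⟨f1, hf1, hinj1⟩ := (hf.comap (freeIncl h)).exists_core hX.isTree
    (isFree_comap (freeIncl_injective h) hX.isFree) hY.isTree
    (isFree_comap (freeIncl_injective h) hY.isFree)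
  obtain ⟨f2, hf2, hinj2⟩ := hf1.exists_erase (isMinimalFreeTree_core_comap hm h hX)
    (isMinimalFreeTree_core_comap hm h hY)
  exact ⟨f2, hf2, fun hinj => hinj2 (hinj1 hinj)⟩

/-- The restriction map. -/
def restrictionMap {m n : ℕ} (hm : 2 ≤ m) (h : m ≤ n) :
    SimplicialMap (outerSpine n) (outerSpine m) :=
  SimplicialMap.ofRel
    (Quotient.lift (fun T : OuterTree n => (T.restrict hm h).toVertex) (by
      rintro S T ⟨e, he⟩
      obtain ⟨f', hf', hinj⟩ := exists_restrictTree_isCollapse hm h S.isMinimalFreeTree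
        T.isMinimalFreeTree (isCollapse_of_iso e he)
      exact OuterTree.toVertex_eq (S := S.restrict hm h) (T := T.restrict hm h) hf'
        (hinj e.injective)))
    (by
      rintro _ _ ⟨S, T, rfl, rfl, f, hf⟩
      obtain ⟨f', hf', -⟩ := exists_restrictTree_isCollapse hm h S.isMinimalFreeTree
        T.isMinimalFreeTree hf.isCollapse
      exact ⟨S.restrict hm h, T.restrict hm h, rfl, rfl, f',
        hf'.isForestCollapse (T.restrict hm h).isFree⟩)

theorem isRestrictionMap_restrictionMap {m n : ℕ} (hm : 2 ≤ m) (h : m ≤ n) :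
    IsRestrictionMap h (restrictionMap hm h) :=
  fun T => ⟨T.restrict hm h, rfl, rfl⟩

/-- Two isomorphisms are composed: erasing respects the identification of `X` with the minimal
`F_m`-invariant subtree of its augmentation, and restriction respects the identification of the
augmentation with its erasure, which removes no vertex since `m < n`. -/
theorem AuterTree.restrict_forget_augment {m n : ℕ} (hm : 2 ≤ m) (hmn : m < n) (T : AuterTree m) :
    (((T.augment hmn.le).forget (hm.trans hmn.le)).restrict hm hmn.le).toVertex =
      (T.forget hm).toVertex := by
  have := nontrivial_freeGroup_fin hm
  have hX := T.isMinimalFreeTree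
  have hZ := augment_isMinimalFreeTree hmn.le T.base hX
  obtain ⟨f1, hf1, hinj1⟩ := exists_isCollapse_core_comap_augment hmn.le T.base hm hX
  obtain ⟨f2, hf2, hinj2⟩ := hf1.exists_erase hX (isMinimalFreeTree_core_comap hm hmn.le hZ)
  have hv := augment_valence_ne_two_of_lt T.base hmn hm hX T.valence_ne
  obtain ⟨f3, hf3, hinj3⟩ := exists_restrictTree_isCollapse hm hmn.le hZ
    (hZ.erase (hm.trans hmn.le)) (isCollapse_erase_of_valence_ne_two hZ.isTree hv)
  have hinj3 := hinj3 fun x y hxy => congrArg Subtype.val hxy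
  obtain ⟨e2, he2, -⟩ := hf2.exists_iso (hinj2 hinj1)
  obtain ⟨e3, he3, -⟩ := hf3.exists_iso hinj3
  have he : IsEquivariantIso (T.forget hm).X
      (((T.augment hmn.le).forget (hm.trans hmn.le)).restrict hm hmn.le).X (e2.trans e3) :=
    fun g v => (congrArg e3 (he2 g v)).trans (he3 g (e2 v))
  exact (OuterTree.toVertex_eq (isCollapse_of_iso _ he) (e2.trans e3).injective).symm

theorem lemma3 (m n : ℕ) (hm : 2 ≤ m) (hmn : m < n) :
    ∃ (ι : SimplicialMap (auterSpine m) (auterSpine n))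
      (φm : SimplicialMap (auterSpine m) (outerSpine m))
      (φn : SimplicialMap (auterSpine n) (outerSpine n))
      (ρ : SimplicialMap (outerSpine n) (outerSpine m)),
      IsAugmentationMap hmn.le ι ∧ IsForgetfulMap φm ∧ IsForgetfulMap φn ∧
      IsRestrictionMap hmn.le ρ ∧
      ∀ x : AuterVertex m, ρ.toFun (φn.toFun (ι.toFun x)) = φm.toFun x := by
  refine ⟨augmentationMap hmn.le, forgetfulMap hm, forgetfulMap (hm.trans hmn.le),
    restrictionMap hm hmn.le, isAugmentationMap_augmentationMap hmn.le,
    isForgetfulMap_forgetfulMap hm, isForgetfulMap_forgetfulMap (hm.trans hmn.le),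
    isRestrictionMap_restrictionMap hm hmn.le, ?_⟩
  rintro ⟨T⟩
  exact T.restrict_forget_augment hm hmn
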